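/- Let $D=(-1,1)$, $0<\beta<1$ and $0<\alpha\le\gamma<2$. For $k\ge 1$ put $\psi_k(x)=\sin\big(\tfrac{k\pi}{2}(x+1)\big)$ (an orthonormal basis of $L^2(D)$), $\bar\mu_k=(k\pi/2)^2$ and $\mu_k=\bar\mu_k^{\alpha/2}+\bar\mu_k^{\gamma/2}$. Let $$\dot H^{\alpha,\gamma}=\Big\{v\in L^2(D):\ \|v\|_{\dot H^{\alpha,\gamma}}^2:=\sum_{k\ge1}\mu_k^2\langle v,\psi_k\rangle^2<\infty\Big\},\qquad L_D^{\alpha,\gamma}v=-\sum_{k\ge1}\mu_k\langle v,\psi_k\rangle\psi_k \quad (v\in\dot H^{\alpha,\gamma}),$$ so that $L_D^{\alpha,\gamma}=-(-\Delta)^{\alpha/2}-(-\Delta)^{\gamma/2}$ with the spectral (Dirichlet) fractional Laplacians on $D$. Let $E_\beta(z)=\sum_{k\ge0}z^k/\Gamma(\beta k+1)$ be the Mittag-Leffler function, and let $$\partial_t^\beta q(t)=\frac1{\Gamma(1-\beta)}\int_0^t (t-s)^{-\beta}q'(s)\,ds$$ be the Caputo derivative of an $L^2(D)$-valued function $q$;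 it is said to exist on $(0,T]$ if $q$ is locally absolutely continuous on $(0,T]$ (the integral of its a.e. derivative $q'$) and the integral converges absolutely for every $t\in(0,T]$. For $T>0$ and $f\in L^2(D)$, a function $u(t,x)$ is called a weak solution of $$\partial_t^\beta u=-(-\Delta)^{\alpha/2}u-(-\Delta)^{\gamma/2}u \ \text{ in } (0,T]\times D,\qquad u=0 \text{ on } \partial D,\qquad u(0,\cdot)=f,$$ if - $u(t,\cdot)\in\dot H^{\alpha,\gamma}$ for each $0<t\le T$; - $u(t,\cdot)=0$ on $\partial D$ for each $0<t\le T$, that is, $u(t,\pm1)=0$ and $u(t,\cdot)$ is a limit in $\dot H^{\alpha,\gamma}$ of elements of $\dot H^{\alpha,\gamma}$ that are continuous on $[-1,1]$ and vanish at $\pm1$; - $\lim_{t\downarrow0}u(t,x)=f(x)$ for a.e. $x\in D$; - the Caputo derivative of $t\mapsto u(t,\cdot)\in L^2(D)$ exists on $(0,T]$, and $\partial_t^\beta u(t,\cdot)=L_D^{\alpha,\gamma}u(t,\cdot)$ in $L^2(D)$ for every $0<t\le T$. **Theorem.** There is a constant $C>0$, depending only on $\alpha,\beta,\gamma$, such that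 for every $T>0$ and every $f\in\dot H^{\alpha,\gamma}$ the following holds. There exists a weak solution $u$ with $u(0,\cdot)=f$, and every weak solution $v$ satisfies $v(t,\cdot)=u(t,\cdot)$ a.e. in $D$ for each $0<t\le T$. The solution is given by $$u(t,\cdot)=\sum_{k=1}^\infty E_\beta(-\mu_k t^\beta)\,\langle f,\psi_k\rangle\,\psi_k\quad\text{in } L^2(D),\qquad 0\le t\le T.$$ Moreover $u\in C([0,T];L^2(D))\cap C((0,T];\dot H^{\alpha,\gamma})$, $\partial_t^\beta u\in C((0,T];L^2(D))$, and $$\|u(t,\cdot)\|_{\dot H^{\alpha,\gamma}}+\|\partial_t^\beta u(t,\cdot)\|_{L^2(D)}\le C\,t^{-\beta}\,\|f\|_{\dot H^{\alpha,\gamma}},\qquad 0<t\le T.$$ -/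

import Mathlib

open MeasureTheory Set Filter Topology

namespace DoubleScale

noncomputable section

/-- Lebesgue measure on the open unit ball `D = (-1, 1)` of the line. -/
abbrev measD : Measure ℝ := volume.restrict (Ioo (-1 : ℝ) 1)

/-- The real Hilbert space `L²(D)`. -/
abbrev L2D : Type := Lp ℝ 2 measD

open Classical in
/-- The class in `L²(D)` of a function on the line (`0` if it is not square integrable on `D`;
wherever this is used below, square integrability is stated or proved separately). -/
def toL2 (g : ℝ → ℝ) : L2D := if h : MemLp g 2 measD then h.toLp g else 0

/-- The `n`-th eigenvalue, `n = 0, 1, 2, …`, of the Dirichlet Laplacian `-Δ` on `D`, i.e.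
`(kπ/2)²` with `k = n + 1`. -/
def dirichletEig (n : ℕ) : ℝ := (((n : ℝ) + 1) * Real.pi / 2) ^ 2

/-- The Dirichlet eigenfunction `x ↦ sin (kπ/2 · (x + 1))` with `k = n + 1`. -/
def psiFun (n : ℕ) (x : ℝ) : ℝ := Real.sin (((n : ℝ) + 1) * Real.pi / 2 * (x + 1))

theorem memLp_psiFun (n : ℕ) : MemLp (psiFun n) 2 measD := by
  refine MemLp.of_bound (C := 1) ?_ (ae_of_all _ fun x => ?_)
  · exact Continuous.aestronglyMeasurable (by unfold psiFun; fun_prop)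
  · simpa [psiFun, Real.norm_eq_abs] using Real.abs_sin_le_one _

/-- The eigenfunction as an element of `L²(D)`; these form an orthonormal basis. -/
def psi (n : ℕ) : L2D := (memLp_psiFun n).toLp (psiFun n)

/-- `μ_k = μ̄_k ^ (α/2) + μ̄_k ^ (γ/2)`, with `k = n + 1`. -/
def eig (α γ : ℝ) (n : ℕ) : ℝ := dirichletEig n ^ (α / 2) + dirichletEig n ^ (γ / 2)

/-- The Fourier coefficient `⟨v, ψ_k⟩`, with `k = n + 1`. -/
def coeff (v : L2D) (n : ℕ) : ℝ := inner ℝ v (psi n)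

/-- Membership in `Ḣ^{α,γ}`, the domain of `-(-Δ)^{α/2} - (-Δ)^{γ/2}` in `L²(D)`. -/
def MemHdot (α γ : ℝ) (v : L2D) : Prop :=
  Summable fun n => eig α γ n ^ 2 * coeff v n ^ 2

/-- The norm of `Ḣ^{α,γ}`. -/
def hdotNorm (α γ : ℝ) (v : L2D) : ℝ :=
  Real.sqrt (∑' n, eig α γ n ^ 2 * coeff v n ^ 2)

/-- The operator `-(-Δ)^{α/2} - (-Δ)^{γ/2}`, spectrally defined on `Ḣ^{α,γ}`. -/
def fracOp (α γ : ℝ) (v : L2D) : L2D :=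
  -∑' n, (coeff v n * eig α γ n) • psi n

/-- The curve `U` lies in `C(S; Ḣ^{α,γ})`. -/
def ContinuousOnHdot (α γ : ℝ) (U : ℝ → L2D) (S : Set ℝ) : Prop :=
  (∀ t ∈ S, MemHdot α γ (U t)) ∧
    ∀ t ∈ S, Tendsto (fun s => hdotNorm α γ (U s - U t)) (𝓝[S] t) (𝓝 0)

/-- Zero boundary values on `∂D = {-1, 1}` for an element of `Ḣ^{α,γ}`: it is a limit in
`Ḣ^{α,γ}` of elements of `Ḣ^{α,γ}` that are continuous on `[-1, 1]` and vanish at `-1` and `1`.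
(Elements of `Ḣ^{α,γ}` have pointwise boundary values only for `γ > 1/2`; for those `γ` the
condition is the usual one.) -/
def ZeroOnBoundary (α γ : ℝ) (v : L2D) : Prop :=
  ∀ ε > 0, ∃ g : ℝ → ℝ, ContinuousOn g (Icc (-1) 1) ∧ g (-1) = 0 ∧ g 1 = 0 ∧
    MemHdot α γ (toL2 g) ∧ hdotNorm α γ (v - toL2 g) < ε

/-- The (two-parameter) Mittag-Leffler function `E_{β,ν}(z) = ∑ z^k / Γ(β k + ν)` at real
arguments. -/
def mittagLeffler (β ν z : ℝ) : ℝ := ∑' k : ℕ, z ^ k / Real.Gamma (β * k + ν)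

variable {E : Type*} [NormedAddCommGroup E] [NormedSpace ℝ E]

/-- The Caputo derivative `Γ(1-β)⁻¹ ∫₀ᵗ (t-s)^{-β} q'(s) ds` of a vector-valued function. -/
def caputoDeriv (β : ℝ) (q : ℝ → E) (t : ℝ) : E :=
  (Real.Gamma (1 - β))⁻¹ • ∫ s in (0 : ℝ)..t, (t - s) ^ (-β) • deriv q s

/-- The Caputo derivative of `q` is meaningful on `(0, T]`: `q` is locally absolutely continuous
on `(0, T]` (it is the integral of its derivative), and the integral that defines the Caputo
derivative converges absolutely at every `t ∈ (0, T]`. -/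
structure HasCaputo (β T : ℝ) (q : ℝ → E) : Prop where
  locallyAC : ∀ a b : ℝ, 0 < a → a ≤ b → b ≤ T →
    IntervalIntegrable (deriv q) volume a b ∧ q b - q a = ∫ s in a..b, deriv q s
  integrable : ∀ t ∈ Ioc 0 T,
    IntervalIntegrable (fun s => (t - s) ^ (-β) • deriv q s) volume 0 t

/-- Weak solutions `u = u(t, x)` on `(0, T] × D` of `∂_t^β u = -(-Δ)^{α/2} u - (-Δ)^{γ/2} u` with
zero boundary values and initial value `f`. Time derivatives are those of `t ↦ u(t, ·) ∈ L²(D)`. -/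
structure IsWeakSolution (β α γ T : ℝ) (f : L2D) (u : ℝ → ℝ → ℝ) : Prop where
  memLp : ∀ t ∈ Ioc 0 T, MemLp (u t) 2 measD
  memHdot : ∀ t ∈ Ioc 0 T, MemHdot α γ (toL2 (u t))
  boundary_value : ∀ t ∈ Ioc 0 T, u t (-1) = 0 ∧ u t 1 = 0
  boundary_trace : ∀ t ∈ Ioc 0 T, ZeroOnBoundary α γ (toL2 (u t))
  initial : ∀ᵐ x ∂measD, Tendsto (fun t => u t x) (𝓝[>] 0) (𝓝 (f x))
  hasCaputo : HasCaputo β T fun t => toL2 (u t)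
  equation : ∀ t ∈ Ioc 0 T,
    caputoDeriv β (fun s => toL2 (u s)) t = fracOp α γ (toL2 (u t))

end

end DoubleScale

open DoubleScale

namespace DoubleScale

/-! ### The Dirichlet sine basis -/

/-! In the sine basis the equation decouples into scalar relaxation equations `∂^β w = -μ w`, one
for each eigenvalue, solved by `E_β(-μ t^β) w(0)`. What remains is to control Mittag-Leffler
functions on the negative half-line, to sum the modes, and to prove scalar uniqueness.

Positivity of `E_{β,ν}(-x)` for `β ≤ ν ≤ 1` comes from comparing the Volterra equation
`volterra_mittagLeffler` at a hypothetical first zero and at a nearby maximum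
(`mittagLeffler_pos_of_pos_before`). Positivity gives the uniform bound, the monotonicity of
`E_β(-t^β)`, and then `x E_β(-x) ≤ Γ(β+1)` (`mul_mittagLeffler_neg_le`), the source of the factor
`t^{-β}`. For `f` in `Ḣ^{α,γ}` the velocity is `O(t^{β-1})` in `L²`, hence integrable at zero, and
its fractional integral is computed mode by mode (`fracOp_solCurve_eq_integral`).

The initial value is attained almost everywhere, not only in `L²`, so representatives must be chosen
with care: `exists_representative` controls all small times at once by the lattice-valued integral
of `|V|`, where `V` is the velocity.

Uniqueness is a maximum principle: at a positive maximum the Caputo derivative is nonnegative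
(`integral_sub_rpow_mul_nonneg`), whereas the equation makes it negative. -/

theorem coeff_eq_integral (v : L2D) (n : ℕ) : coeff v n = ∫ x, v x * psiFun n x ∂measD := by
  rw [coeff, L2.inner_def]
  refine integral_congr_ae ?_
  filter_upwards [(memLp_psiFun n).coeFn_toLp] with x hx
  simp [psi, hx, mul_comm]

theorem integral_cos_int_mul (j : ℤ) :
    ∫ x in (-1 : ℝ)..1, Real.cos (j * Real.pi / 2 * (x + 1)) = if j = 0 then 2 else 0 := by
  split_ifs with hj
  · subst hj; norm_num
  · have hc : (j : ℝ) * Real.pi / 2 ≠ 0 := by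
      have : (j : ℝ) ≠ 0 := by exact_mod_cast hj
      positivity
    have h : ∀ x ∈ uIcc (-1 : ℝ) 1,
        HasDerivAt (fun x : ℝ => Real.sin (j * Real.pi / 2 * (x + 1)) / (j * Real.pi / 2))
          (Real.cos (j * Real.pi / 2 * (x + 1))) x := by
      intro x _
      have h1 : HasDerivAt (fun x : ℝ => j * Real.pi / 2 * (x + 1)) (j * Real.pi / 2 * 1) x :=
        ((hasDerivAt_id x).add_const 1).const_mul _
      refine (h1.sin.div_const (j * Real.pi / 2)).congr_deriv ?_
      field_simp
    rw [intervalIntegral.integral_eq_sub_of_hasDerivAt h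
      (Continuous.intervalIntegrable (by fun_prop) _ _)]
    have : (j : ℝ) * Real.pi / 2 * (1 + 1) = j * Real.pi := by ring
    rw [this, Real.sin_int_mul_pi]
    norm_num

theorem integral_psiFun_mul (m n : ℕ) :
    ∫ x, psiFun m x * psiFun n x ∂measD = if m = n then 1 else 0 := by
  have h1 : ∫ x, psiFun m x * psiFun n x ∂measD
      = ∫ x in (-1 : ℝ)..1, psiFun m x * psiFun n x := by
    rw [intervalIntegral.integral_of_le (by norm_num), integral_Ioc_eq_integral_Ioo]
  have h2 : ∀ x, psiFun m x * psiFun n x =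
      1 / 2 * Real.cos (((m - n : ℤ) : ℝ) * Real.pi / 2 * (x + 1))
      - 1 / 2 * Real.cos (((m + n + 2 : ℤ) : ℝ) * Real.pi / 2 * (x + 1)) := by
    intro x
    have e1 : ((m - n : ℤ) : ℝ) * Real.pi / 2 * (x + 1)
        = ((m : ℝ) + 1) * Real.pi / 2 * (x + 1) - ((n : ℝ) + 1) * Real.pi / 2 * (x + 1) := by
      push_cast; ring
    have e2 : ((m + n + 2 : ℤ) : ℝ) * Real.pi / 2 * (x + 1)
        = ((m : ℝ) + 1) * Real.pi / 2 * (x + 1) + ((n : ℝ) + 1) * Real.pi / 2 * (x + 1) := by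
      push_cast; ring
    rw [e1, e2, Real.cos_sub, Real.cos_add, psiFun, psiFun]
    ring
  rw [h1, intervalIntegral.integral_congr (fun x _ => h2 x), intervalIntegral.integral_sub,
    intervalIntegral.integral_const_mul, intervalIntegral.integral_const_mul,
    integral_cos_int_mul, integral_cos_int_mul]
  · have : ((m : ℤ) + n + 2) ≠ 0 := by positivity
    rw [if_neg this]
    by_cases h : m = n
    · simp [h]
    · have : ((m : ℤ) - n) ≠ 0 := by omega
      simp [h, this]
  all_goals exact Continuous.intervalIntegrable (by fun_prop) _ _

theorem orthonormal_psi : Orthonormal ℝ psi := by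
  rw [orthonormal_iff_ite]
  intro m n
  rw [← integral_psiFun_mul m n]
  refine (coeff_eq_integral (psi m) n).trans (integral_congr_ae ?_)
  filter_upwards [(memLp_psiFun m).coeFn_toLp] with x hx
  simp [psi, hx]

/-- `cos (π (x + 1) / 2)`. -/
noncomputable def halfCos (x : ℝ) : ℝ := Real.cos (Real.pi / 2 * (x + 1))

theorem continuous_halfCos : Continuous halfCos := by unfold halfCos; fun_prop

theorem continuous_psiFun (n : ℕ) : Continuous (psiFun n) := by unfold psiFun; fun_prop

theorem abs_psiFun_le_one (n : ℕ) (x : ℝ) : |psiFun n x| ≤ 1 := Real.abs_sin_le_one _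

theorem psiFun_zero_mul_halfCos (x : ℝ) : psiFun 0 x * halfCos x = 1 / 2 * psiFun 1 x := by
  have e : ((1 : ℕ) + 1 : ℝ) * Real.pi / 2 * (x + 1) = 2 * (Real.pi / 2 * (x + 1)) := by
    push_cast; ring
  rw [psiFun, psiFun, halfCos, e, Real.sin_two_mul]
  simp only [Nat.cast_zero, zero_add, one_mul]
  ring

theorem psiFun_succ_mul_halfCos (n : ℕ) (x : ℝ) :
    psiFun (n + 1) x * halfCos x = 1 / 2 * psiFun (n + 2) x + 1 / 2 * psiFun n x := by
  have e1 : (((n + 2 : ℕ) : ℝ) + 1) * Real.pi / 2 * (x + 1)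
      = (((n + 1 : ℕ) : ℝ) + 1) * Real.pi / 2 * (x + 1) + Real.pi / 2 * (x + 1) := by
    push_cast; ring
  have e2 : (((n : ℕ) : ℝ) + 1) * Real.pi / 2 * (x + 1)
      = (((n + 1 : ℕ) : ℝ) + 1) * Real.pi / 2 * (x + 1) - Real.pi / 2 * (x + 1) := by
    push_cast; ring
  rw [psiFun, psiFun, psiFun, halfCos, e1, e2, Real.sin_add, Real.sin_sub]
  ring

theorem integrable_coeFn (v : L2D) : Integrable v measD :=
  (Lp.memLp v).integrable (by norm_num)

theorem integrable_mul_of_continuous (v : L2D) {h : ℝ → ℝ} (hc : Continuous h) {c : ℝ}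
    (hb : ∀ x, |h x| ≤ c) : Integrable (fun x => v x * h x) measD :=
  (integrable_coeFn v).mul_bdd hc.aestronglyMeasurable (ae_of_all _ hb)

theorem abs_psiFun_mul_halfCos_pow_le (n m : ℕ) (x : ℝ) : |psiFun n x * halfCos x ^ m| ≤ 1 := by
  rw [abs_mul, abs_pow]
  exact mul_le_one₀ (abs_psiFun_le_one n x) (by positivity)
    (pow_le_one₀ (abs_nonneg _) (Real.abs_cos_le_one _))

theorem integrable_mul_psiFun_mul_pow (v : L2D) (n m : ℕ) :
    Integrable (fun x => v x * (psiFun n x * halfCos x ^ m)) measD :=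
  integrable_mul_of_continuous v ((continuous_psiFun n).mul (continuous_halfCos.pow m))
    (abs_psiFun_mul_halfCos_pow_le n m)

/-- Multiplying a sine mode by `halfCos` gives a combination of the neighbouring modes, so
orthogonality to all modes survives each extra factor. -/
theorem integral_mul_psiFun_mul_pow {v : L2D} (hv : ∀ n, coeff v n = 0) (m : ℕ) :
    ∀ n, ∫ x, v x * (psiFun n x * halfCos x ^ m) ∂measD = 0 := by
  induction m with
  | zero => intro n; simpa [coeff_eq_integral] using hv n
  | succ m ih =>
    intro n
    rcases n with _ | n
    · have : ∀ x, v x * (psiFun 0 x * halfCos x ^ (m + 1))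
          = 1 / 2 * (v x * (psiFun 1 x * halfCos x ^ m)) := fun x => by
        rw [pow_succ', ← mul_assoc (psiFun 0 x), psiFun_zero_mul_halfCos]; ring
      simp_rw [this]
      rw [integral_const_mul, ih, mul_zero]
    · have : ∀ x, v x * (psiFun (n + 1) x * halfCos x ^ (m + 1))
          = 1 / 2 * (v x * (psiFun (n + 2) x * halfCos x ^ m))
            + 1 / 2 * (v x * (psiFun n x * halfCos x ^ m)) := fun x => by
        rw [pow_succ', ← mul_assoc (psiFun (n + 1) x), psiFun_succ_mul_halfCos]; ring
      simp_rw [this]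
      rw [integral_add ((integrable_mul_psiFun_mul_pow v _ m).const_mul _)
        ((integrable_mul_psiFun_mul_pow v _ m).const_mul _), integral_const_mul,
        integral_const_mul, ih, ih]
      simp

theorem integral_mul_psiFun_mul_polynomial {v : L2D} (hv : ∀ n, coeff v n = 0)
    (p : Polynomial ℝ) :
    ∫ x, v x * (psiFun 0 x * p.eval (halfCos x)) ∂measD = 0 := by
  have : ∀ x, v x * (psiFun 0 x * p.eval (halfCos x)) =
      ∑ i ∈ Finset.range (p.natDegree + 1),
        p.coeff i * (v x * (psiFun 0 x * halfCos x ^ i)) := fun x => by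
    rw [Polynomial.eval_eq_sum_range, Finset.mul_sum, Finset.mul_sum]
    exact Finset.sum_congr rfl fun i _ => by ring
  simp_rw [this]
  rw [integral_finsetSum _ fun i _ => (integrable_mul_psiFun_mul_pow v 0 i).const_mul _]
  simp [integral_const_mul, integral_mul_psiFun_mul_pow hv]

theorem integral_mul_psiFun_mul_continuous {v : L2D} (hv : ∀ n, coeff v n = 0)
    {h : ℝ → ℝ} (hc : Continuous h) : ∫ x, v x * (psiFun 0 x * h x) ∂measD = 0 := by
  -- `halfCos` is injective on `D`; `k` is `h` composed with its inverse. Weierstrass applied to `k`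
  -- approximates `h` uniformly on `D` by polynomials in `halfCos`.
  set k : ℝ → ℝ := fun c => h (2 / Real.pi * Real.arccos c - 1) with hk
  have hkc : Continuous k := hc.comp (by fun_prop)
  have hkh : ∀ x ∈ Ioo (-1 : ℝ) 1, k (halfCos x) = h x := by
    intro x hx
    have hp := Real.pi_pos
    rw [hk, halfCos]
    simp only
    rw [Real.arccos_cos (by have := hx.1; apply mul_nonneg <;> linarith)
      (by nlinarith [hx.2])]
    congr 1
    field_simp
    ring
  have key : ∀ ε > 0, |∫ x, v x * (psiFun 0 x * h x) ∂measD| ≤ ε * ∫ x, |v x| ∂measD := by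
    intro ε hε
    obtain ⟨p, hp⟩ := exists_polynomial_near_of_continuousOn (-1) 1 k hkc.continuousOn ε hε
    have hpk : ∀ x, |p.eval (halfCos x) - k (halfCos x)| ≤ ε := fun x =>
      (hp _ ⟨Real.neg_one_le_cos _, Real.cos_le_one _⟩).le
    have e : ∫ x, v x * (psiFun 0 x * h x) ∂measD
        = ∫ x, v x * (psiFun 0 x * (k (halfCos x) - p.eval (halfCos x))) ∂measD := by
      have i1 : Integrable
          (fun x => v x * (psiFun 0 x * (k (halfCos x) - p.eval (halfCos x)))) measD := by
        refine integrable_mul_of_continuous v (c := ε) ((continuous_psiFun 0).mul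
          ((hkc.comp continuous_halfCos).sub (p.continuous.comp continuous_halfCos))) fun x => ?_
        rw [abs_mul, abs_sub_comm]
        exact (mul_le_of_le_one_left (abs_nonneg _) (abs_psiFun_le_one _ _)).trans (hpk x)
      have i2 : Integrable (fun x => v x * (psiFun 0 x * p.eval (halfCos x))) measD := by
        have : ∀ x, v x * (psiFun 0 x * p.eval (halfCos x)) =
            ∑ i ∈ Finset.range (p.natDegree + 1),
              p.coeff i * (v x * (psiFun 0 x * halfCos x ^ i)) := fun x => by
          rw [Polynomial.eval_eq_sum_range, Finset.mul_sum, Finset.mul_sum]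
          exact Finset.sum_congr rfl fun i _ => by ring
        simp_rw [this]
        exact integrable_finsetSum _ fun i _ => (integrable_mul_psiFun_mul_pow v 0 i).const_mul _
      rw [← add_zero (∫ x, v x * (psiFun 0 x * (k (halfCos x) - p.eval (halfCos x))) ∂measD),
        ← integral_mul_psiFun_mul_polynomial hv p, ← integral_add i1 i2]
      refine integral_congr_ae ?_
      filter_upwards [ae_restrict_mem measurableSet_Ioo] with x hx
      rw [← hkh x hx]; ring
    rw [e, ← integral_const_mul]
    refine (abs_integral_le_integral_abs).trans ?_
    refine integral_mono_of_nonneg (ae_of_all _ fun x => abs_nonneg _)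
      ((integrable_coeFn v).abs.const_mul ε) (ae_of_all _ fun x => ?_)
    simp only [abs_mul]
    rw [mul_comm]
    refine mul_le_mul_of_nonneg_right ?_ (abs_nonneg _)
    rw [abs_sub_comm]
    exact (mul_le_of_le_one_left (abs_nonneg _) (abs_psiFun_le_one _ _)).trans (hpk x)
  have hlim : Tendsto (fun ε : ℝ => ε * ∫ x, |v x| ∂measD) (𝓝[>] 0) (𝓝 0) := by
    have : Continuous fun ε : ℝ => ε * ∫ x, |v x| ∂measD := by fun_prop
    simpa using (this.tendsto 0).mono_left nhdsWithin_le_nhds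
  exact abs_nonpos_iff.1 (ge_of_tendsto hlim (by
    filter_upwards [self_mem_nhdsWithin] with ε hε using key ε hε))

/-- Completeness of the sines: `v * psiFun 0` annihilates every test function, hence vanishes a.e.,
and `psiFun 0` is strictly positive on `D`. -/
theorem eq_zero_of_coeff_eq_zero {v : L2D} (hv : ∀ n, coeff v n = 0) : v = 0 := by
  have hint : Integrable (fun x => v x * psiFun 0 x) measD :=
    integrable_mul_of_continuous v (continuous_psiFun 0) (abs_psiFun_le_one 0)
  have h0 := ae_eq_zero_of_integral_contDiff_smul_eq_zero hint.locallyIntegrable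
    fun g hg _ => by
      rw [← integral_mul_psiFun_mul_continuous hv hg.continuous]
      exact integral_congr_ae (ae_of_all _ fun x => by simp only [smul_eq_mul]; ring)
  rw [Lp.eq_zero_iff_ae_eq_zero]
  filter_upwards [h0, ae_restrict_mem measurableSet_Ioo] with x hx hxD
  have hp := Real.pi_pos
  have : 0 < psiFun 0 x := by
    rw [psiFun]
    apply Real.sin_pos_of_pos_of_lt_pi
    · have : 0 < x + 1 := by linarith [hxD.1]
      simp only [Nat.cast_zero, zero_add, one_mul]
      positivity
    · simp only [Nat.cast_zero, zero_add, one_mul]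
      nlinarith [hxD.2]
  simpa [this.ne'] using hx

/-- The Dirichlet sine functions as a Hilbert basis of `L²(D)`. -/
noncomputable def sineBasis : HilbertBasis ℕ ℝ L2D :=
  HilbertBasis.mkOfOrthogonalEqBot orthonormal_psi <| by
    rw [Submodule.eq_bot_iff]
    intro v hv
    refine eq_zero_of_coeff_eq_zero fun n => ?_
    exact Submodule.inner_left_of_mem_orthogonal
      (Submodule.subset_span (mem_range_self n)) hv

theorem sineBasis_apply (n : ℕ) : sineBasis n = psi n := by
  rw [sineBasis, HilbertBasis.coe_mkOfOrthogonalEqBot]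

theorem sineBasis_repr (v : L2D) (n : ℕ) : sineBasis.repr v n = coeff v n := by
  rw [HilbertBasis.repr_apply_apply, sineBasis_apply, coeff, real_inner_comm]

theorem hasSum_coeff_smul_psi (v : L2D) : HasSum (fun n => coeff v n • psi n) v := by
  simpa [sineBasis_repr, sineBasis_apply] using sineBasis.hasSum_repr v

theorem hasSum_coeff_sq (v : L2D) : HasSum (fun n => coeff v n ^ 2) (‖v‖ ^ 2) := by
  have := sineBasis.hasSum_inner_mul_inner v v
  rw [real_inner_self_eq_norm_sq] at this
  refine this.congr_fun fun n => ?_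
  rw [sineBasis_apply, coeff, real_inner_comm v, sq]

theorem ext_coeff {v w : L2D} (h : ∀ n, coeff v n = coeff w n) : v = w := by
  rw [← sub_eq_zero]
  refine eq_zero_of_coeff_eq_zero fun n => ?_
  rw [coeff, inner_sub_left, sub_eq_zero]
  exact h n

theorem exists_of_summable_sq {c : ℕ → ℝ} (hc : Summable fun n => c n ^ 2) :
    ∃ v : L2D, ∀ n, coeff v n = c n := by
  have hm : Memℓp c 2 := by
    rw [memℓp_gen_iff (by norm_num)]
    simpa using hc
  refine ⟨sineBasis.repr.symm ⟨c, hm⟩, fun n => ?_⟩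
  rw [← sineBasis_repr]
  simp

open Classical in
/-- The element of `L²(D)` with given square summable Fourier coefficients. -/
noncomputable def ofCoeff (c : ℕ → ℝ) : L2D :=
  if hc : Summable fun n => c n ^ 2 then (exists_of_summable_sq hc).choose else 0

theorem coeff_ofCoeff {c : ℕ → ℝ} (hc : Summable fun n => c n ^ 2) (n : ℕ) :
    coeff (ofCoeff c) n = c n := by
  rw [ofCoeff, dif_pos hc]
  exact (exists_of_summable_sq hc).choose_spec n

/-! ### The Mittag-Leffler function -/

/-- Keep only the part of the Gamma integral over `(R, ∞)`, where `x^(y-1) ≥ R^(y-1)`. As `R` is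
free, `Γ` outgrows every geometric sequence. -/
theorem rpow_mul_exp_neg_le_Gamma {R y : ℝ} (hR : 0 < R) (hy : 1 ≤ y) :
    R ^ (y - 1) * Real.exp (-R) ≤ Real.Gamma y := by
  have hy0 : 0 < y := by linarith
  have hi := Real.GammaIntegral_convergent hy0
  rw [Real.Gamma_eq_integral hy0, ← integral_exp_neg_Ioi, ← integral_const_mul]
  calc ∫ x in Ioi R, R ^ (y - 1) * Real.exp (-x)
      ≤ ∫ x in Ioi R, Real.exp (-x) * x ^ (y - 1) := by
        refine setIntegral_mono_on ((integrableOn_exp_neg_Ioi R).const_mul _)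
          (hi.mono_set (Ioi_subset_Ioi hR.le)) measurableSet_Ioi fun x hx => ?_
        rw [mul_comm]
        gcongr
        exact le_of_lt hx
    _ ≤ ∫ x in Ioi 0, Real.exp (-x) * x ^ (y - 1) := by
        refine setIntegral_mono_set hi ?_ (Ioi_subset_Ioi hR.le).eventuallyLE
        filter_upwards [ae_restrict_mem measurableSet_Ioi] with x hx
        have : (0 : ℝ) < x := hx
        simp only [Pi.zero_apply]
        positivity

theorem summable_mittagLeffler {β : ℝ} (hβ : 0 < β) (ν z : ℝ) :
    Summable fun k : ℕ => z ^ k / Real.Gamma (β * k + ν) := by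
  -- With `R^β = M`, `Γ(βk + ν)` is at least a constant times `M^k`; since `|z| ≤ M/2`, the terms
  -- are dominated by a geometric series of ratio `1/2`.
  set M : ℝ := 2 * (|z| + 1) with hM
  have hMpos : 0 < M := by positivity
  set R : ℝ := M ^ (1 / β)
  have hR : 0 < R := Real.rpow_pos_of_pos hMpos _
  refine Summable.of_norm_bounded_eventually_nat
    (g := fun k => (1 / 2 : ℝ) ^ k * (Real.exp R / R ^ (ν - 1)))
    ((summable_geometric_of_lt_one (by norm_num) (by norm_num)).mul_right _) ?_
  have hlarge : ∀ᶠ k : ℕ in atTop, 1 ≤ β * k + ν := by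
    have : Tendsto (fun k : ℕ => β * k + ν) atTop atTop :=
      tendsto_atTop_add_const_right _ _ (tendsto_natCast_atTop_atTop.const_mul_atTop hβ)
    exact this.eventually_ge_atTop 1
  filter_upwards [hlarge] with k hk
  have hG := rpow_mul_exp_neg_le_Gamma hR hk
  have hRk : R ^ (β * k + ν - 1) = M ^ k * R ^ (ν - 1) := by
    rw [add_sub_assoc, Real.rpow_add hR, ← Real.rpow_mul hMpos.le]
    congr 1
    rw [← Real.rpow_natCast]
    congr 1
    field_simp
  rw [hRk] at hG
  have hG0 : 0 < Real.Gamma (β * k + ν) := Real.Gamma_pos_of_pos (by linarith)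
  rw [norm_div, norm_pow, Real.norm_eq_abs, Real.norm_of_nonneg hG0.le]
  have hRν : 0 < R ^ (ν - 1) := Real.rpow_pos_of_pos hR _
  have hz : |z| ^ k ≤ (1 / 2) ^ k * M ^ k := by
    rw [← mul_pow]
    exact pow_le_pow_left₀ (abs_nonneg _) (by rw [hM]; linarith) _
  rw [div_le_iff₀ hG0]
  calc |z| ^ k ≤ (1 / 2) ^ k * M ^ k := hz
    _ = (1 / 2) ^ k * (Real.exp R / R ^ (ν - 1)) * (M ^ k * R ^ (ν - 1) * Real.exp (-R)) := by
        rw [Real.exp_neg]; field_simp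
    _ ≤ _ := by gcongr

theorem continuous_mittagLeffler {β ν : ℝ} (hβ : 0 < β) (hν : 0 < ν) :
    Continuous (mittagLeffler β ν) := by
  rw [continuous_iff_continuousAt]
  intro z
  have hc : ContinuousOn (mittagLeffler β ν) (Metric.ball 0 (|z| + 1)) := by
    refine continuousOn_tsum (fun k => by fun_prop)
      (summable_mittagLeffler hβ ν (|z| + 1)) fun k x hx => ?_
    have hG0 : 0 < Real.Gamma (β * k + ν) := Real.Gamma_pos_of_pos (by positivity)
    rw [norm_div, norm_pow, Real.norm_of_nonneg hG0.le]
    gcongr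
    simpa using (mem_ball_zero_iff.1 hx).le
  exact hc.continuousAt (Metric.isOpen_ball.mem_nhds (by simp))

theorem mittagLeffler_zero {β ν : ℝ} : mittagLeffler β ν 0 = (Real.Gamma ν)⁻¹ := by
  rw [mittagLeffler, tsum_eq_single 0]
  · simp
  · intro k hk; simp [hk]

theorem mittagLeffler_eq_add {β ν : ℝ} (hβ : 0 < β) (z : ℝ) :
    mittagLeffler β ν z = (Real.Gamma ν)⁻¹ + z * mittagLeffler β (ν + β) z := by
  rw [mittagLeffler, (summable_mittagLeffler hβ ν z).tsum_eq_zero_add, mittagLeffler,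
    ← tsum_mul_left]
  congr 1
  · simp
  · congr 1
    ext k
    rw [pow_succ', mul_div_assoc]
    congr 3
    push_cast
    ring

/-! ### Fractional integrals of Mittag-Leffler functions -/

theorem integral_sub_rpow_mul_rpow {a b t : ℝ} (ha : 0 < a) (hb : 0 < b) (ht : 0 < t) :
    ∫ s in (0 : ℝ)..t, (t - s) ^ (a - 1) * s ^ (b - 1)
      = t ^ (a + b - 1) * (Real.Gamma a * Real.Gamma b / Real.Gamma (a + b)) := by
  have h := Complex.betaIntegral_scaled (b : ℂ) (a : ℂ) ht
  rw [Complex.betaIntegral_eq_Gamma_mul_div _ _ (by simpa using hb) (by simpa using ha)] at h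
  have e : ∫ x in (0 : ℝ)..t, (x : ℂ) ^ ((b : ℂ) - 1) * ((t : ℂ) - x) ^ ((a : ℂ) - 1)
      = ((∫ s in (0 : ℝ)..t, (t - s) ^ (a - 1) * s ^ (b - 1) : ℝ) : ℂ) := by
    rw [← intervalIntegral.integral_ofReal]
    refine intervalIntegral.integral_congr fun x hx => ?_
    rw [uIcc_of_le ht.le] at hx
    push_cast
    rw [Complex.ofReal_cpow hx.1, Complex.ofReal_cpow (sub_nonneg.2 hx.2)]
    push_cast
    ring
  rw [e] at h
  have h' : ((t : ℂ) ^ ((b : ℂ) + a - 1) * (Complex.Gamma b * Complex.Gamma a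
      / Complex.Gamma (b + a))) = ((t ^ (a + b - 1) *
      (Real.Gamma a * Real.Gamma b / Real.Gamma (a + b)) : ℝ) : ℂ) := by
    push_cast
    rw [Complex.ofReal_cpow ht.le, ← Complex.Gamma_ofReal, ← Complex.Gamma_ofReal,
      ← Complex.Gamma_ofReal]
    push_cast
    rw [add_comm (b : ℂ), mul_comm (Complex.Gamma b)]
  rw [h'] at h
  exact_mod_cast h

theorem intervalIntegrable_sub_rpow_mul_rpow {a b t : ℝ} (ha : 0 < a) (hb : 0 < b)
    (ht : 0 < t) :
    IntervalIntegrable (fun s => (t - s) ^ (a - 1) * s ^ (b - 1)) volume 0 t := by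
  -- A non-integrable function has integral `0` by convention, but the beta integral is positive.
  by_contra hn
  have h0 := intervalIntegral.integral_undef hn
  rw [integral_sub_rpow_mul_rpow ha hb ht] at h0
  have h1 := Real.Gamma_pos_of_pos ha
  have h2 := Real.Gamma_pos_of_pos hb
  have h3 := Real.Gamma_pos_of_pos (add_pos ha hb)
  have : 0 < t ^ (a + b - 1) * (Real.Gamma a * Real.Gamma b / Real.Gamma (a + b)) := by
    positivity
  exact this.ne' h0

theorem continuous_mittagLeffler_mul_rpow {β ν : ℝ} (hβ : 0 < β) (hν : 0 < ν) (c : ℝ) :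
    Continuous fun s : ℝ => mittagLeffler β ν (c * s ^ β) :=
  (continuous_mittagLeffler hβ hν).comp
    (continuous_const.mul (continuous_id.rpow_const fun _ => Or.inr hβ.le))

theorem intervalIntegrable_sub_rpow_mul_mittagLeffler {β ν a t : ℝ} (hβ : 0 < β) (hν : 0 < ν)
    (ha : 0 < a) (ht : 0 < t) (c : ℝ) :
    IntervalIntegrable (fun s => (t - s) ^ (a - 1) *
      (s ^ (ν - 1) * mittagLeffler β ν (c * s ^ β))) volume 0 t := by
  simp_rw [← mul_assoc]
  exact (intervalIntegrable_sub_rpow_mul_rpow ha hν ht).mul_continuousOn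
    (continuous_mittagLeffler_mul_rpow hβ hν c).continuousOn

/-- The Riemann-Liouville integral of `s ^ (ν - 1) E_{β,ν}(c s ^ β)`. -/
theorem integral_sub_rpow_mul_mittagLeffler {β ν a t : ℝ} (hβ : 0 < β) (hν : 0 < ν)
    (ha : 0 < a) (ht : 0 < t) (c : ℝ) :
    ∫ s in (0 : ℝ)..t, (t - s) ^ (a - 1) * (s ^ (ν - 1) * mittagLeffler β ν (c * s ^ β))
      = Real.Gamma a * (t ^ (ν + a - 1) * mittagLeffler β (ν + a) (c * t ^ β)) := by
  have hk : ∀ k : ℕ, 0 < β * k + ν := fun k => by positivity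
  have hG : ∀ k : ℕ, 0 < Real.Gamma (β * k + ν) := fun k => Real.Gamma_pos_of_pos (hk k)
  set F : ℕ → ℝ → ℝ := fun k s =>
    c ^ k / Real.Gamma (β * k + ν) * ((t - s) ^ (a - 1) * s ^ (β * k + ν - 1)) with hF
  have hFi : ∀ k, Integrable (F k) (volume.restrict (Ioc 0 t)) := fun k =>
    ((intervalIntegrable_iff_integrableOn_Ioc_of_le ht.le).1
      (intervalIntegrable_sub_rpow_mul_rpow ha (hk k) ht)).const_mul _
  have hval : ∀ (d : ℝ) (k : ℕ), ∫ s in Ioc 0 t, d ^ k / Real.Gamma (β * k + ν) *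
      ((t - s) ^ (a - 1) * s ^ (β * k + ν - 1))
      = Real.Gamma a * (t ^ (ν + a - 1) *
        ((d * t ^ β) ^ k / Real.Gamma (β * k + (ν + a)))) := by
    intro d k
    rw [integral_const_mul, ← intervalIntegral.integral_of_le ht.le,
      integral_sub_rpow_mul_rpow ha (hk k) ht]
    have e1 : a + (β * k + ν) - 1 = β * k + (ν + a - 1) := by ring
    have e2 : a + (β * k + ν) = β * k + (ν + a) := by ring
    rw [e1, e2, Real.rpow_add ht, Real.rpow_mul ht.le, Real.rpow_natCast, mul_pow]
    have := (hG k).ne'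
    field_simp
  -- The norms integrate to the terms of the same series with `|c|` in place of `c`; its convergence
  -- justifies termwise integration.
  have hnorm : ∀ k, ∫ s in Ioc 0 t, ‖F k s‖
      = Real.Gamma a * (t ^ (ν + a - 1) *
        ((|c| * t ^ β) ^ k / Real.Gamma (β * k + (ν + a)))) := by
    intro k
    rw [← hval]
    refine setIntegral_congr_fun measurableSet_Ioc fun s hs => ?_
    have h1 : 0 ≤ (t - s) ^ (a - 1) := Real.rpow_nonneg (sub_nonneg.2 hs.2) _
    have h2 : 0 ≤ s ^ (β * k + ν - 1) := Real.rpow_nonneg hs.1.le _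
    simp only [hF, norm_mul, norm_div, norm_pow, Real.norm_eq_abs, abs_of_nonneg h1,
      abs_of_nonneg h2, abs_of_pos (hG k)]
  have hsum := hasSum_integral_of_summable_integral_norm hFi (by
    simp_rw [hnorm]
    exact ((summable_mittagLeffler hβ (ν + a) _).mul_left _).mul_left _)
  rw [intervalIntegral.integral_of_le ht.le]
  have hL : ∫ s in Ioc 0 t, ∑' k, F k s = ∫ s in Ioc 0 t,
      (t - s) ^ (a - 1) * (s ^ (ν - 1) * mittagLeffler β ν (c * s ^ β)) := by
    refine setIntegral_congr_fun measurableSet_Ioc fun s hs => ?_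
    simp only [mittagLeffler, ← tsum_mul_left]
    congr 1
    ext k
    rw [hF]
    simp only
    rw [add_sub_assoc, Real.rpow_add hs.1, Real.rpow_mul hs.1.le, Real.rpow_natCast, mul_pow]
    ring
  rw [← hL, ← hsum.tsum_eq, mittagLeffler, ← tsum_mul_left, ← tsum_mul_left]
  congr 1
  ext k
  exact hval c k

/-! ### Positivity and bounds on the negative half-line -/

/-- The factor `(t₀/t)^(ν-1)` is the one by which the forcing term `t^(ν-1)` of the Volterra
equation scales from `t` to `t₀`, so the forcing cancels when the two equations are compared. The
hypothesis `β ≤ ν` is what allows this exponent. -/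
theorem sub_rpow_le_div_rpow_mul {β ν s t t₀ : ℝ} (hβν : β ≤ ν) (hν1 : ν ≤ 1)
    (hs : 0 < s) (hst : s < t) (htt : t < t₀) :
    (t₀ - s) ^ (β - 1) ≤ (t₀ / t) ^ (ν - 1) * (t - s) ^ (β - 1) := by
  have ht : 0 < t := hs.trans hst
  have h1 : 1 ≤ t₀ / t := by rw [one_le_div ht]; exact htt.le
  have hts : 0 < t - s := sub_pos.2 hst
  have h2 : t₀ / t * (t - s) ≤ t₀ - s := by
    rw [div_mul_eq_mul_div, div_le_iff₀ ht]
    nlinarith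
  calc (t₀ - s) ^ (β - 1) ≤ (t₀ / t * (t - s)) ^ (β - 1) :=
        Real.rpow_le_rpow_of_nonpos (by positivity) h2 (by linarith)
    _ = (t₀ / t) ^ (β - 1) * (t - s) ^ (β - 1) := Real.mul_rpow (by positivity) hts.le
    _ ≤ _ := by
      gcongr

theorem integral_sub_rpow {β t t₀ : ℝ} (hβ : 0 < β) :
    ∫ s in t..t₀, (t₀ - s) ^ (β - 1) = (t₀ - t) ^ β / β := by
  rw [intervalIntegral.integral_comp_sub_left (fun s => s ^ (β - 1)) t₀,
    integral_rpow (Or.inl (by linarith))]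
  simp [Real.zero_rpow hβ.ne']

theorem volterra_mittagLeffler {β ν t : ℝ} (hβ : 0 < β) (hν : 0 < ν) (ht : 0 < t) (c : ℝ) :
    t ^ (ν - 1) * mittagLeffler β ν (c * t ^ β) = t ^ (ν - 1) / Real.Gamma ν
      + c / Real.Gamma β * ∫ s in (0 : ℝ)..t,
        (t - s) ^ (β - 1) * (s ^ (ν - 1) * mittagLeffler β ν (c * s ^ β)) := by
  have hG := (Real.Gamma_pos_of_pos hβ).ne'
  rw [integral_sub_rpow_mul_mittagLeffler hβ hν hβ ht, mittagLeffler_eq_add hβ,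
    add_sub_right_comm, Real.rpow_add ht]
  field_simp

/-- A solution of the Volterra equation that is positive before `t₀` is positive at `t₀`. -/
theorem mittagLeffler_pos_of_pos_before {β ν t₀ : ℝ} (hβ : 0 < β)
    (hβν : β ≤ ν) (hν1 : ν ≤ 1) (ht₀ : 0 < t₀)
    (hpos : ∀ s ∈ Ioo 0 t₀, 0 < mittagLeffler β ν (-1 * s ^ β)) :
    0 < mittagLeffler β ν (-1 * t₀ ^ β) := by
  have hν : 0 < ν := hβ.trans_le hβν
  have hGβ := Real.Gamma_pos_of_pos hβ
  set y : ℝ → ℝ := fun t => t ^ (ν - 1) * mittagLeffler β ν (-1 * t ^ β) with hy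
  have hypos : ∀ s ∈ Ioo 0 t₀, 0 < y s := fun s hs =>
    mul_pos (Real.rpow_pos_of_pos hs.1 _) (hpos s hs)
  by_contra hneg
  have hy0 : y t₀ ≤ 0 :=
    mul_nonpos_of_nonneg_of_nonpos (Real.rpow_nonneg ht₀.le _) (not_lt.1 hneg)
  -- As `t₁ → t₀` the left side (the normalised kernel mass on `[t₁, t₀]`) tends to `0` and the
  -- right side to `1`.
  obtain ⟨t₁, ht₁, h₁⟩ : ∃ t₁ ∈ Ioo 0 t₀,
      (t₀ - t₁) ^ β / (β * Real.Gamma β) < (t₁ / t₀) ^ (1 - ν) := by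
    have hA : ContinuousAt (fun r : ℝ => (t₀ - r) ^ β / (β * Real.Gamma β)) t₀ :=
      ((continuousAt_const.sub continuousAt_id).rpow_const (Or.inr hβ.le)).div_const _
    have hB : ContinuousAt (fun r : ℝ => (r / t₀) ^ (1 - ν)) t₀ :=
      (continuousAt_id.div_const _).rpow_const (Or.inr (by linarith))
    have hlt : ∀ᶠ r in 𝓝 t₀, (t₀ - r) ^ β / (β * Real.Gamma β) < (r / t₀) ^ (1 - ν) := by
      refine hA.eventually_lt hB ?_
      simp [Real.zero_rpow hβ.ne', div_self ht₀.ne']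
    obtain ⟨r, hr⟩ := ((hlt.filter_mono nhdsWithin_le_nhds).and
      (Ioo_mem_nhdsLT ht₀)).exists
    exact ⟨r, hr.2, hr.1⟩
  have hyc : ContinuousOn y (Icc t₁ t₀) := by
    refine ContinuousOn.mul (fun s hs => ?_)
      (continuous_mittagLeffler_mul_rpow hβ hν (-1)).continuousOn
    exact (Real.continuousAt_rpow_const _ _
      (Or.inl (ht₁.1.trans_le hs.1).ne')).continuousWithinAt
  -- At a maximum `t` of `y` on `[t₁, t₀]`, put `ρ = (t₀/t)^(ν-1)`. The history before `t` costs at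
  -- most `ρ` times its contribution at `t`, the stretch from `t` to `t₀` costs less than `ρ * y t`,
  -- and so `y t₀ > 0`.
  obtain ⟨t, ht, hmax⟩ := isCompact_Icc.exists_isMaxOn (nonempty_Icc.2 ht₁.2.le) hyc
  have hyt : 0 < y t := (hypos t₁ ht₁).trans_le (hmax (left_mem_Icc.2 ht₁.2.le))
  have htt : t < t₀ := lt_of_le_of_ne ht.2 (by rintro rfl; linarith)
  have htpos : 0 < t := ht₁.1.trans_le ht.1
  have hI : IntervalIntegrable (fun s => (t₀ - s) ^ (β - 1) * y s) volume 0 t₀ :=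
    intervalIntegrable_sub_rpow_mul_mittagLeffler hβ hν hβ ht₀ (-1)
  have hI1 : IntervalIntegrable (fun s => (t₀ - s) ^ (β - 1) * y s) volume 0 t :=
    hI.mono_set (by
      rw [uIcc_of_le htpos.le, uIcc_of_le ht₀.le]; exact Icc_subset_Icc_right htt.le)
  have hI2 : IntervalIntegrable (fun s => (t₀ - s) ^ (β - 1) * y s) volume t t₀ :=
    hI.mono_set (by
      rw [uIcc_of_le htt.le, uIcc_of_le ht₀.le]; exact Icc_subset_Icc_left htpos.le)
  have hI3 : IntervalIntegrable (fun s => (t - s) ^ (β - 1) * y s) volume 0 t :=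
    intervalIntegrable_sub_rpow_mul_mittagLeffler hβ hν hβ htpos (-1)
  have b1 : ∫ s in (0 : ℝ)..t, (t₀ - s) ^ (β - 1) * y s
      ≤ (t₀ / t) ^ (ν - 1) * ∫ s in (0 : ℝ)..t, (t - s) ^ (β - 1) * y s := by
    rw [← intervalIntegral.integral_const_mul]
    refine intervalIntegral.integral_mono_on_of_le_Ioo htpos.le hI1 (hI3.const_mul _)
      fun s hs => ?_
    exact (mul_le_mul_of_nonneg_right (sub_rpow_le_div_rpow_mul hβν hν1 hs.1 hs.2 htt)
      (hypos s ⟨hs.1, hs.2.trans htt⟩).le).trans_eq (mul_assoc _ _ _)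
  have b2 : ∫ s in t..t₀, (t₀ - s) ^ (β - 1) * y s ≤ (t₀ - t) ^ β / β * y t := by
    rw [← integral_sub_rpow hβ, ← intervalIntegral.integral_mul_const]
    refine intervalIntegral.integral_mono_on htt.le hI2 ?_ fun s hs => ?_
    · have : IntervalIntegrable (fun s : ℝ => s ^ (β - 1)) volume (t₀ - t) (t₀ - t₀) :=
        intervalIntegral.intervalIntegrable_rpow' (by linarith)
      simpa using (this.comp_sub_left t₀).mul_const (y t)
    · exact mul_le_mul_of_nonneg_left (hmax ⟨ht.1.trans hs.1, hs.2⟩)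
        (Real.rpow_nonneg (sub_nonneg.2 hs.2) _)
  have v0 := volterra_mittagLeffler hβ hν ht₀ (-1)
  have v1 := volterra_mittagLeffler hβ hν htpos (-1)
  change y t₀ = _ + _ * ∫ s in (0 : ℝ)..t₀, (t₀ - s) ^ (β - 1) * y s at v0
  change y t = _ + _ * ∫ s in (0 : ℝ)..t, (t - s) ^ (β - 1) * y s at v1
  rw [← intervalIntegral.integral_add_adjacent_intervals hI1 hI2] at v0
  set A := ∫ s in (0 : ℝ)..t, (t₀ - s) ^ (β - 1) * y s
  set B := ∫ s in t..t₀, (t₀ - s) ^ (β - 1) * y s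
  set D := ∫ s in (0 : ℝ)..t, (t - s) ^ (β - 1) * y s
  have hρ : (t₀ / t) ^ (ν - 1) * t ^ (ν - 1) = t₀ ^ (ν - 1) := by
    rw [← Real.mul_rpow (by positivity) htpos.le, div_mul_cancel₀ _ htpos.ne']
  have hρ' : (t₁ / t₀) ^ (1 - ν) ≤ (t₀ / t) ^ (ν - 1) := by
    rw [← neg_sub 1 ν, Real.rpow_neg (by positivity), ← Real.inv_rpow (by positivity), inv_div]
    exact Real.rpow_le_rpow (div_nonneg ht₁.1.le ht₀.le)
      (by gcongr; exact ht.1) (by linarith)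
  have hτ : (t₀ - t) ^ β / (β * Real.Gamma β) ≤ (t₀ - t₁) ^ β / (β * Real.Gamma β) := by
    gcongr
    exact ht.1
  have hBG : B / Real.Gamma β ≤ (t₀ - t) ^ β / (β * Real.Gamma β) * y t := by
    rw [div_le_iff₀ hGβ]
    refine b2.trans_eq ?_
    field_simp
  have hAG : A / Real.Gamma β ≤ (t₀ / t) ^ (ν - 1) * (D / Real.Gamma β) := by
    rw [← mul_div_assoc]
    gcongr
  have key : (t₀ / t) ^ (ν - 1) * y t
      = t₀ ^ (ν - 1) / Real.Gamma ν - (t₀ / t) ^ (ν - 1) * (D / Real.Gamma β) := by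
    rw [v1, ← hρ]; ring
  have v0' : y t₀ = t₀ ^ (ν - 1) / Real.Gamma ν - A / Real.Gamma β - B / Real.Gamma β := by
    rw [v0]; ring
  have fin : (t₀ - t) ^ β / (β * Real.Gamma β) * y t < (t₀ / t) ^ (ν - 1) * y t :=
    mul_lt_mul_of_pos_right (by linarith) hyt
  linarith

theorem exists_rpow_eq {β x : ℝ} (hβ : 0 < β) (hx : 0 ≤ x) : ∃ t, 0 ≤ t ∧ t ^ β = x :=
  ⟨x ^ β⁻¹, Real.rpow_nonneg hx _, by
    rw [← Real.rpow_mul hx, inv_mul_cancel₀ hβ.ne', Real.rpow_one]⟩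

/-- The set of times with nonpositive value is closed and misses `0`, where the value is `1/Γ(ν)`;
its least element would contradict `mittagLeffler_pos_of_pos_before`. -/
theorem mittagLeffler_neg_pos {β ν x : ℝ} (hβ : 0 < β) (hβν : β ≤ ν) (hν1 : ν ≤ 1)
    (hx : 0 ≤ x) : 0 < mittagLeffler β ν (-x) := by
  have hν : 0 < ν := hβ.trans_le hβν
  obtain ⟨t, ht, rfl⟩ := exists_rpow_eq hβ hx
  by_contra hneg
  set S : Set ℝ := {r | 0 ≤ r ∧ mittagLeffler β ν (-1 * r ^ β) ≤ 0} with hS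
  have hSc : IsClosed S := isClosed_Ici.inter
    (isClosed_le (continuous_mittagLeffler_mul_rpow hβ hν (-1)) continuous_const)
  have hSn : S.Nonempty := ⟨t, ht, by simpa using hneg⟩
  have hSb : BddBelow S := ⟨0, fun r hr => hr.1⟩
  obtain ⟨h0, h1⟩ : sInf S ∈ S := hSc.csInf_mem hSn hSb
  rcases h0.eq_or_lt with h0 | h0
  · rw [← h0, Real.zero_rpow hβ.ne', mul_zero, mittagLeffler_zero] at h1
    exact (inv_pos.2 (Real.Gamma_pos_of_pos hν)).not_ge h1
  · refine (mittagLeffler_pos_of_pos_before hβ hβν hν1 h0 fun s hs => ?_).not_ge h1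
    by_contra hs'
    exact (csInf_le hSb ⟨hs.1.le, not_lt.1 hs'⟩).not_gt hs.2

/-- Up to a positive factor this is a fractional integral of the positive function with index `ν`;
it reaches indices above `1`, needed in the recursion behind the upper bound. -/
theorem mittagLeffler_add_neg_nonneg {β ν a x : ℝ} (hβ : 0 < β) (hβν : β ≤ ν) (hν1 : ν ≤ 1)
    (ha : 0 < a) (hx : 0 ≤ x) : 0 ≤ mittagLeffler β (ν + a) (-x) := by
  have hν : 0 < ν := hβ.trans_le hβν
  obtain ⟨t, ht, rfl⟩ := exists_rpow_eq hβ hx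
  rcases ht.eq_or_lt with rfl | ht
  · rw [Real.zero_rpow hβ.ne', neg_zero, mittagLeffler_zero]
    exact (inv_pos.2 (Real.Gamma_pos_of_pos (add_pos hν ha))).le
  · have h := integral_sub_rpow_mul_mittagLeffler hβ hν ha ht (-1)
    have hnn : 0 ≤ ∫ s in (0 : ℝ)..t,
        (t - s) ^ (a - 1) * (s ^ (ν - 1) * mittagLeffler β ν (-1 * s ^ β)) := by
      refine intervalIntegral.integral_nonneg ht.le fun s hs => ?_
      have h1 := Real.rpow_nonneg (sub_nonneg.2 hs.2) (a - 1)
      have h2 := Real.rpow_nonneg hs.1 (ν - 1)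
      have h3 := (mittagLeffler_neg_pos hβ hβν hν1 (Real.rpow_nonneg hs.1 β)).le
      rw [← neg_one_mul] at h3
      positivity
    rw [h, neg_one_mul] at hnn
    have hp := Real.rpow_pos_of_pos ht (ν + a - 1)
    exact nonneg_of_mul_nonneg_right (nonneg_of_mul_nonneg_right hnn
      (Real.Gamma_pos_of_pos ha)) hp

theorem mittagLeffler_neg_le {β ν x : ℝ} (hβ : 0 < β) (hβν : β ≤ ν) (hν1 : ν ≤ 1)
    (hx : 0 ≤ x) : mittagLeffler β ν (-x) ≤ (Real.Gamma ν)⁻¹ := by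
  rw [mittagLeffler_eq_add hβ]
  nlinarith [mittagLeffler_add_neg_nonneg hβ hβν hν1 hβ hx]

theorem abs_mittagLeffler_neg_le {β ν x : ℝ} (hβ : 0 < β) (hβν : β ≤ ν) (hν1 : ν ≤ 1)
    (hx : 0 ≤ x) : |mittagLeffler β ν (-x)| ≤ (Real.Gamma ν)⁻¹ := by
  rw [abs_of_pos (mittagLeffler_neg_pos hβ hβν hν1 hx)]
  exact mittagLeffler_neg_le hβ hβν hν1 hx

theorem intervalIntegrable_rpow_mul_mittagLeffler {β : ℝ} (hβ : 0 < β) (c s t : ℝ) :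
    IntervalIntegrable (fun r => r ^ (β - 1) * mittagLeffler β β (c * r ^ β)) volume s t :=
  (intervalIntegral.intervalIntegrable_rpow' (by linarith)).mul_continuousOn
    (continuous_mittagLeffler_mul_rpow hβ hβ c).continuousOn

theorem mittagLeffler_eq_one_add_integral {β t : ℝ} (hβ : 0 < β) (ht : 0 ≤ t) (c : ℝ) :
    mittagLeffler β 1 (c * t ^ β)
      = 1 + c * ∫ r in (0 : ℝ)..t, r ^ (β - 1) * mittagLeffler β β (c * r ^ β) := by
  rcases ht.eq_or_lt with rfl | ht
  · simp [Real.zero_rpow hβ.ne', mittagLeffler_zero]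
  · have h := integral_sub_rpow_mul_mittagLeffler hβ hβ one_pos ht c
    simp only [sub_self, Real.rpow_zero, one_mul, Real.Gamma_one, add_sub_cancel_right] at h
    rw [h, mittagLeffler_eq_add hβ, Real.Gamma_one, add_comm β 1]
    ring

/-- The integrated form of the time derivative of `E_β(c t^β)`: it comes from the fractional
integral of order one and needs no differentiation of the series. -/
theorem mittagLeffler_sub_eq_integral {β s t : ℝ} (hβ : 0 < β) (hs : 0 ≤ s) (ht : 0 ≤ t)
    (c : ℝ) :
    mittagLeffler β 1 (c * t ^ β) - mittagLeffler β 1 (c * s ^ β)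
      = ∫ r in s..t, c * (r ^ (β - 1) * mittagLeffler β β (c * r ^ β)) := by
  rw [mittagLeffler_eq_one_add_integral hβ ht, mittagLeffler_eq_one_add_integral hβ hs,
    intervalIntegral.integral_const_mul, ← intervalIntegral.integral_interval_sub_left
      (intervalIntegrable_rpow_mul_mittagLeffler hβ c 0 t)
      (intervalIntegrable_rpow_mul_mittagLeffler hβ c 0 s)]
  ring

theorem mittagLeffler_neg_rpow_antitone {β s t : ℝ} (hβ : 0 < β) (hβ1 : β ≤ 1)
    (hs : 0 ≤ s) (hst : s ≤ t) :
    mittagLeffler β 1 (-1 * t ^ β) ≤ mittagLeffler β 1 (-1 * s ^ β) := by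
  rw [← sub_nonpos, mittagLeffler_sub_eq_integral hβ hs (hs.trans hst),
    intervalIntegral.integral_const_mul, neg_one_mul, neg_nonpos]
  refine intervalIntegral.integral_nonneg hst fun r hr => ?_
  have h0 : 0 ≤ r := hs.trans hr.1
  have h1 := (mittagLeffler_neg_pos hβ le_rfl hβ1 (Real.rpow_nonneg h0 β)).le
  rw [← neg_one_mul] at h1
  exact mul_nonneg (Real.rpow_nonneg h0 _) h1

/-- In the Volterra equation with `ν = 1`, positivity bounds the integral above by `Γ(β)`, while
monotonicity bounds it below by the final value times the kernel mass `t^β/β`. -/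
theorem mul_mittagLeffler_neg_le {β x : ℝ} (hβ : 0 < β) (hβ1 : β ≤ 1) (hx : 0 ≤ x) :
    x * mittagLeffler β 1 (-x) ≤ Real.Gamma (β + 1) := by
  obtain ⟨t, ht, rfl⟩ := exists_rpow_eq hβ hx
  have hGβ := Real.Gamma_pos_of_pos hβ
  rcases ht.eq_or_lt with rfl | ht
  · rw [Real.zero_rpow hβ.ne', zero_mul]
    exact (Real.Gamma_pos_of_pos (by linarith)).le
  have hv := volterra_mittagLeffler hβ one_pos ht (-1)
  have hI := intervalIntegrable_sub_rpow_mul_mittagLeffler hβ one_pos hβ ht (-1)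
  simp only [sub_self, Real.rpow_zero, one_mul, Real.Gamma_one, div_one] at hv hI
  have hlow : mittagLeffler β 1 (-1 * t ^ β) * (t ^ β / β)
      ≤ ∫ s in (0 : ℝ)..t, (t - s) ^ (β - 1) * mittagLeffler β 1 (-1 * s ^ β) := by
    have e := integral_sub_rpow (t := 0) (t₀ := t) hβ
    rw [sub_zero] at e
    rw [← e, mul_comm, ← intervalIntegral.integral_mul_const]
    refine intervalIntegral.integral_mono_on ht.le ?_ hI fun s hs => ?_
    · have : IntervalIntegrable (fun s : ℝ => s ^ (β - 1)) volume (t - 0) (t - t) :=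
        intervalIntegral.intervalIntegrable_rpow' (by linarith)
      simpa using (this.comp_sub_left t).mul_const _
    · exact mul_le_mul_of_nonneg_left (mittagLeffler_neg_rpow_antitone hβ hβ1 hs.1 hs.2)
        (Real.rpow_nonneg (sub_nonneg.2 hs.2) _)
  have hp := mittagLeffler_neg_pos hβ hβ1 le_rfl (Real.rpow_nonneg ht.le β)
  rw [← neg_one_mul] at hp ⊢
  have hle : (∫ s in (0 : ℝ)..t, (t - s) ^ (β - 1) * mittagLeffler β 1 (-1 * s ^ β))
      ≤ Real.Gamma β := by
    have : (∫ s in (0 : ℝ)..t, (t - s) ^ (β - 1) * mittagLeffler β 1 (-1 * s ^ β))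
        / Real.Gamma β ≤ 1 := by
      have h2 : (-1 / Real.Gamma β) *
          (∫ s in (0 : ℝ)..t, (t - s) ^ (β - 1) * mittagLeffler β 1 (-1 * s ^ β))
          = -((∫ s in (0 : ℝ)..t, (t - s) ^ (β - 1) * mittagLeffler β 1 (-1 * s ^ β))
            / Real.Gamma β) := by ring
      rw [h2] at hv
      linarith
    rwa [div_le_one hGβ] at this
  rw [Real.Gamma_add_one hβ.ne']
  have h3 := hlow.trans hle
  rw [mul_div_assoc', div_le_iff₀ hβ] at h3
  linarith

/-! ### Fourier coefficients -/

theorem coeff_sub (v w : L2D) (n : ℕ) : coeff (v - w) n = coeff v n - coeff w n :=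
  inner_sub_left _ _ _

theorem coeff_neg (v : L2D) (n : ℕ) : coeff (-v) n = -coeff v n := inner_neg_left _ _

theorem coeff_smul (c : ℝ) (v : L2D) (n : ℕ) : coeff (c • v) n = c * coeff v n :=
  real_inner_smul_left _ _ _

theorem coeff_psi (m n : ℕ) : coeff (psi m) n = if m = n then 1 else 0 :=
  orthonormal_iff_ite.1 orthonormal_psi m n

theorem coeff_sum_smul_psi (s : Finset ℕ) (c : ℕ → ℝ) (n : ℕ) :
    coeff (∑ k ∈ s, c k • psi k) n = if n ∈ s then c n else 0 := by
  have : coeff (∑ k ∈ s, c k • psi k) n = ∑ k ∈ s, coeff (c k • psi k) n := sum_inner _ _ _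
  simp [this, coeff_smul, coeff_psi]

theorem coeff_eq_innerSL (v : L2D) (n : ℕ) : coeff v n = innerSL ℝ (psi n) v := by
  rw [innerSL_apply_apply, coeff, real_inner_comm]

theorem continuous_coeff (n : ℕ) : Continuous fun v : L2D => coeff v n := by
  simp_rw [coeff_eq_innerSL]
  exact (innerSL ℝ (psi n)).continuous

theorem coeff_intervalIntegral {V : ℝ → L2D} {a b : ℝ} (hV : IntervalIntegrable V volume a b)
    (n : ℕ) : coeff (∫ r in a..b, V r) n = ∫ r in a..b, coeff (V r) n := by
  simp_rw [coeff_eq_innerSL]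
  exact ((innerSL ℝ (psi n)).intervalIntegral_comp_comm hV).symm

theorem intervalIntegrable_coeff {V : ℝ → L2D} {a b : ℝ}
    (hV : IntervalIntegrable V volume a b) (n : ℕ) :
    IntervalIntegrable (fun r => coeff (V r) n) volume a b := by
  simp_rw [coeff_eq_innerSL]
  exact ⟨(innerSL ℝ (psi n)).integrable_comp hV.1, (innerSL ℝ (psi n)).integrable_comp hV.2⟩

theorem norm_eq_sqrt_tsum_coeff (v : L2D) : ‖v‖ = √(∑' n, coeff v n ^ 2) := by
  rw [(hasSum_coeff_sq v).tsum_eq, Real.sqrt_sq (norm_nonneg _)]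

theorem summable_sq_of_abs_le {a d : ℕ → ℝ} (hd : Summable fun n => d n ^ 2)
    (h : ∀ n, |a n| ≤ |d n|) : Summable fun n => a n ^ 2 :=
  Summable.of_nonneg_of_le (fun _ => sq_nonneg _) (fun n => sq_le_sq.2 (h n)) hd

theorem sqrt_tsum_sq_le {a d : ℕ → ℝ} {C : ℝ} (hC : 0 ≤ C) (hd : Summable fun n => d n ^ 2)
    (h : ∀ n, |a n| ≤ C * |d n|) : √(∑' n, a n ^ 2) ≤ C * √(∑' n, d n ^ 2) := by
  have h' : ∀ n, a n ^ 2 ≤ C ^ 2 * d n ^ 2 := fun n => by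
    rw [← mul_pow, sq_le_sq, abs_mul, abs_of_nonneg hC]
    exact h n
  have hs := hd.mul_left (C ^ 2)
  rw [← Real.sqrt_sq hC, ← Real.sqrt_mul (sq_nonneg C), ← tsum_mul_left]
  exact Real.sqrt_le_sqrt ((Summable.of_nonneg_of_le (fun _ => sq_nonneg _) h' hs).tsum_le_tsum
    h' hs)

/-- Dominated convergence over the modes; all continuity statements in `L²` and in `Ḣ^{α,γ}` reduce
to it. -/
theorem tendsto_sqrt_tsum_sq {ι : Type*} {l : Filter ι} {a : ι → ℕ → ℝ} {d : ℕ → ℝ}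
    (hd : Summable fun n => d n ^ 2) (hb : ∀ᶠ i in l, ∀ n, |a i n| ≤ |d n|)
    (ha : ∀ n, Tendsto (fun i => a i n) l (𝓝 0)) :
    Tendsto (fun i => √(∑' n, a i n ^ 2)) l (𝓝 0) := by
  have h : Tendsto (fun i => ∑' n, a i n ^ 2) l (𝓝 (∑' _ : ℕ, (0 : ℝ))) := by
    refine tendsto_tsum_of_dominated_convergence hd (fun n => ?_) ?_
    · simpa using (ha n).pow 2
    · filter_upwards [hb] with i hi n
      rw [Real.norm_of_nonneg (sq_nonneg _)]
      exact sq_le_sq.2 (hi n)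
  simpa using h.sqrt

theorem tendsto_of_coeff {ι : Type*} {l : Filter ι} {V : ι → L2D} {v : L2D} {d : ℕ → ℝ}
    (hd : Summable fun n => d n ^ 2) (hb : ∀ᶠ i in l, ∀ n, |coeff (V i) n - coeff v n| ≤ |d n|)
    (ha : ∀ n, Tendsto (fun i => coeff (V i) n) l (𝓝 (coeff v n))) : Tendsto V l (𝓝 v) := by
  rw [tendsto_iff_norm_sub_tendsto_zero]
  simp_rw [norm_eq_sqrt_tsum_coeff, coeff_sub]
  exact tendsto_sqrt_tsum_sq hd hb fun n => tendsto_sub_nhds_zero_iff.2 (ha n)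

/-! ### Eigenvalues and the space `Ḣ^{α,γ}` -/

theorem one_le_dirichletEig (n : ℕ) : 1 ≤ dirichletEig n := by
  have h : 1 ≤ ((n : ℝ) + 1) * Real.pi / 2 := by
    have h1 := Real.pi_gt_three
    have h2 : (0 : ℝ) ≤ n := n.cast_nonneg
    nlinarith
  exact one_le_pow₀ h

theorem one_le_eig {α γ : ℝ} (hα : 0 ≤ α) (hγ : 0 ≤ γ) (n : ℕ) : 1 ≤ eig α γ n := by
  have h1 := Real.one_le_rpow (one_le_dirichletEig n) (show 0 ≤ α / 2 by linarith)
  have h2 := Real.one_le_rpow (one_le_dirichletEig n) (show 0 ≤ γ / 2 by linarith)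
  rw [eig]
  linarith

theorem eig_pos {α γ : ℝ} (n : ℕ) : 0 < eig α γ n := by
  have h := zero_lt_one.trans_le (one_le_dirichletEig n)
  exact add_pos (Real.rpow_pos_of_pos h _) (Real.rpow_pos_of_pos h _)

theorem memHdot_iff {α γ : ℝ} {v : L2D} :
    MemHdot α γ v ↔ Summable fun n => (eig α γ n * coeff v n) ^ 2 := by
  simp_rw [MemHdot, mul_pow]

theorem hdotNorm_eq (α γ : ℝ) (v : L2D) :
    hdotNorm α γ v = √(∑' n, (eig α γ n * coeff v n) ^ 2) := by
  simp_rw [hdotNorm, mul_pow]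

theorem coeff_fracOp {α γ : ℝ} {v : L2D} (hv : MemHdot α γ v) (n : ℕ) :
    coeff (fracOp α γ v) n = -(eig α γ n * coeff v n) := by
  have h := hasSum_coeff_smul_psi (ofCoeff fun n => eig α γ n * coeff v n)
  simp_rw [coeff_ofCoeff (memHdot_iff.1 hv), mul_comm (eig α γ _)] at h
  rw [fracOp, h.tsum_eq, coeff_neg]
  simp_rw [mul_comm _ (eig α γ _)]
  rw [coeff_ofCoeff (memHdot_iff.1 hv)]

theorem norm_fracOp {α γ : ℝ} {v : L2D} (hv : MemHdot α γ v) :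
    ‖fracOp α γ v‖ = hdotNorm α γ v := by
  rw [norm_eq_sqrt_tsum_coeff, hdotNorm_eq]
  simp_rw [coeff_fracOp hv, neg_sq]

/-! ### The solution curve and its velocity -/

/-- `∑ E_β(-μ_k t ^ β) ⟨f, ψ_k⟩ ψ_k`. -/
noncomputable def solCurve (β α γ : ℝ) (f : L2D) (t : ℝ) : L2D :=
  ofCoeff fun n => mittagLeffler β 1 (-eig α γ n * t ^ β) * coeff f n

/-- The time derivative of `solCurve`. -/
noncomputable def velCurve (β α γ : ℝ) (f : L2D) (t : ℝ) : L2D :=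
  ofCoeff fun n => t ^ (β - 1) * mittagLeffler β β (-eig α γ n * t ^ β) *
    (-(eig α γ n * coeff f n))

section Curves

variable {β α γ : ℝ} {f : L2D}

theorem abs_mittagLeffler_eig_le {ν t : ℝ} (hβ : 0 < β) (hβν : β ≤ ν) (hν1 : ν ≤ 1)
    (ht : 0 ≤ t) (n : ℕ) :
    |mittagLeffler β ν (-eig α γ n * t ^ β)| ≤ (Real.Gamma ν)⁻¹ := by
  rw [neg_mul]
  exact abs_mittagLeffler_neg_le hβ hβν hν1
    (mul_nonneg (eig_pos n).le (Real.rpow_nonneg ht β))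

theorem abs_mittagLeffler_one_eig_le {t : ℝ} (hβ : 0 < β) (hβ1 : β ≤ 1)
    (ht : 0 ≤ t) (n : ℕ) : |mittagLeffler β 1 (-eig α γ n * t ^ β)| ≤ 1 := by
  simpa using abs_mittagLeffler_eig_le (α := α) (γ := γ) hβ hβ1 le_rfl ht n

theorem abs_mittagLeffler_eig_mul_le {t : ℝ} (hβ : 0 < β) (hβ1 : β ≤ 1)
    (ht : 0 ≤ t) (n : ℕ) (c : ℝ) : |mittagLeffler β 1 (-eig α γ n * t ^ β) * c| ≤ |c| := by
  rw [abs_mul]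
  exact mul_le_of_le_one_left (abs_nonneg _) (abs_mittagLeffler_one_eig_le hβ hβ1 ht n)

theorem coeff_solCurve (hβ : 0 < β) (hβ1 : β ≤ 1) {t : ℝ} (ht : 0 ≤ t) (n : ℕ) :
    coeff (solCurve β α γ f t) n = mittagLeffler β 1 (-eig α γ n * t ^ β) * coeff f n :=
  coeff_ofCoeff (summable_sq_of_abs_le (hasSum_coeff_sq f).summable fun n =>
    abs_mittagLeffler_eig_mul_le hβ hβ1 ht n _) n

theorem solCurve_zero (hβ : 0 < β) (hβ1 : β ≤ 1) : solCurve β α γ f 0 = f :=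
  ext_coeff fun n => by
    rw [coeff_solCurve hβ hβ1 le_rfl, Real.zero_rpow hβ.ne', mul_zero, mittagLeffler_zero]
    simp

theorem abs_velCurve_coeff_le (hβ : 0 < β) (hβ1 : β ≤ 1) {t : ℝ} (ht : 0 ≤ t) (n : ℕ) :
    |t ^ (β - 1) * mittagLeffler β β (-eig α γ n * t ^ β) * (-(eig α γ n * coeff f n))|
      ≤ t ^ (β - 1) * (Real.Gamma β)⁻¹ * |eig α γ n * coeff f n| := by
  have h := Real.rpow_nonneg ht (β - 1)
  rw [abs_mul, abs_mul, abs_neg, abs_of_nonneg h]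
  gcongr
  exact abs_mittagLeffler_eig_le hβ le_rfl hβ1 ht n

theorem coeff_velCurve (hβ : 0 < β) (hβ1 : β ≤ 1) (hf : MemHdot α γ f) {t : ℝ} (ht : 0 ≤ t)
    (n : ℕ) :
    coeff (velCurve β α γ f t) n = t ^ (β - 1) * mittagLeffler β β (-eig α γ n * t ^ β) *
      (-(eig α γ n * coeff f n)) := by
  refine coeff_ofCoeff (summable_sq_of_abs_le (d := fun n => t ^ (β - 1) * (Real.Gamma β)⁻¹ *
    (eig α γ n * coeff f n)) ?_ fun n => (abs_velCurve_coeff_le hβ hβ1 ht n).trans ?_) n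
  · simp_rw [mul_pow _ (eig α γ _ * coeff f _)]
    exact (memHdot_iff.1 hf).mul_left _
  · rw [abs_mul (t ^ (β - 1) * (Real.Gamma β)⁻¹)]
    gcongr
    exact le_abs_self _

/-- The regularity of `f` pays for the eigenvalue in the velocity, which leaves only the integrable
singularity `t^(β-1)`. -/
theorem norm_velCurve_le (hβ : 0 < β) (hβ1 : β ≤ 1) (hf : MemHdot α γ f) {t : ℝ}
    (ht : 0 ≤ t) :
    ‖velCurve β α γ f t‖ ≤ t ^ (β - 1) * (Real.Gamma β)⁻¹ * hdotNorm α γ f := by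
  have hG := Real.Gamma_pos_of_pos hβ
  have h := Real.rpow_nonneg ht (β - 1)
  rw [norm_eq_sqrt_tsum_coeff, hdotNorm_eq]
  simp_rw [coeff_velCurve hβ hβ1 hf ht]
  exact sqrt_tsum_sq_le (by positivity) (memHdot_iff.1 hf) (abs_velCurve_coeff_le hβ hβ1 ht)

theorem continuousOn_solCurve (hβ : 0 < β) (hβ1 : β ≤ 1) :
    ContinuousOn (solCurve β α γ f) (Ici 0) := by
  intro t ht
  refine tendsto_of_coeff (d := fun n => 2 * coeff f n) ?_ ?_ fun n => ?_
  · simp_rw [mul_pow]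
    exact (hasSum_coeff_sq f).summable.mul_left _
  · filter_upwards [self_mem_nhdsWithin] with s hs n
    rw [coeff_solCurve hβ hβ1 ht, coeff_solCurve hβ hβ1 hs, abs_mul, abs_two, two_mul]
    exact (abs_sub _ _).trans (add_le_add (abs_mittagLeffler_eig_mul_le hβ hβ1 hs n _)
      (abs_mittagLeffler_eig_mul_le hβ hβ1 ht n _))
  · rw [coeff_solCurve hβ hβ1 ht]
    refine Tendsto.congr' (f₁ := fun s => mittagLeffler β 1 (-eig α γ n * s ^ β) * coeff f n)
      ?_ ?_
    · filter_upwards [self_mem_nhdsWithin] with s hs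
      rw [coeff_solCurve hβ hβ1 hs]
    · exact (((continuous_mittagLeffler_mul_rpow hβ one_pos _).tendsto t).mono_left
        nhdsWithin_le_nhds).mul_const _

theorem memHdot_solCurve (hβ : 0 < β) (hβ1 : β ≤ 1) (hf : MemHdot α γ f) {t : ℝ}
    (ht : 0 ≤ t) : MemHdot α γ (solCurve β α γ f t) := by
  rw [memHdot_iff]
  refine summable_sq_of_abs_le (memHdot_iff.1 hf) fun n => ?_
  rw [coeff_solCurve hβ hβ1 ht, mul_left_comm]
  exact abs_mittagLeffler_eig_mul_le hβ hβ1 ht n _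

theorem tendsto_hdotNorm_solCurve_sub (hβ : 0 < β) (hβ1 : β ≤ 1) (hf : MemHdot α γ f) {t : ℝ}
    (ht : 0 ≤ t) :
    Tendsto (fun s => hdotNorm α γ (solCurve β α γ f s - solCurve β α γ f t)) (𝓝[Ici 0] t)
      (𝓝 0) := by
  simp_rw [hdotNorm_eq]
  refine tendsto_sqrt_tsum_sq (d := fun n => 2 * (eig α γ n * coeff f n)) ?_ ?_ fun n => ?_
  · simp_rw [mul_pow (2 : ℝ)]
    exact (memHdot_iff.1 hf).mul_left _
  · filter_upwards [self_mem_nhdsWithin] with s hs n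
    rw [coeff_sub, coeff_solCurve hβ hβ1 ht, coeff_solCurve hβ hβ1 hs, abs_mul 2, abs_two,
      two_mul, mul_sub, mul_left_comm, mul_left_comm (eig α γ n)]
    exact (abs_sub _ _).trans (add_le_add (abs_mittagLeffler_eig_mul_le hβ hβ1 hs n _)
      (abs_mittagLeffler_eig_mul_le hβ hβ1 ht n _))
  · have h := ((continuous_coeff n).tendsto _).comp (continuousOn_solCurve (α := α) (γ := γ)
      (f := f) hβ hβ1 t ht)
    have h' := (tendsto_sub_nhds_zero_iff.2 h).const_mul (eig α γ n)
    rw [mul_zero] at h'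
    exact h'.congr fun s => by rw [coeff_sub]; rfl

theorem norm_fracOp_sub_solCurve (hβ : 0 < β) (hβ1 : β ≤ 1) (hf : MemHdot α γ f) {s t : ℝ}
    (hs : 0 ≤ s) (ht : 0 ≤ t) :
    ‖fracOp α γ (solCurve β α γ f s) - fracOp α γ (solCurve β α γ f t)‖
      = hdotNorm α γ (solCurve β α γ f s - solCurve β α γ f t) := by
  rw [norm_eq_sqrt_tsum_coeff, hdotNorm_eq]
  congr 2
  ext n
  rw [coeff_sub, coeff_sub, coeff_fracOp (memHdot_solCurve hβ hβ1 hf hs),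
    coeff_fracOp (memHdot_solCurve hβ hβ1 hf ht)]
  ring

theorem continuousOn_fracOp_solCurve (hβ : 0 < β) (hβ1 : β ≤ 1) (hf : MemHdot α γ f) :
    ContinuousOn (fun t => fracOp α γ (solCurve β α γ f t)) (Ici 0) := by
  intro t ht
  rw [ContinuousWithinAt, tendsto_iff_norm_sub_tendsto_zero]
  refine (tendsto_hdotNorm_solCurve_sub hβ hβ1 hf ht).congr' ?_
  filter_upwards [self_mem_nhdsWithin] with s hs
  rw [norm_fracOp_sub_solCurve hβ hβ1 hf hs ht]

theorem hdotNorm_solCurve_le (hβ : 0 < β) (hβ1 : β ≤ 1) (hα : 0 ≤ α) (hγ : 0 ≤ γ)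
    (hf : MemHdot α γ f) {t : ℝ} (ht : 0 < t) :
    hdotNorm α γ (solCurve β α γ f t) ≤ Real.Gamma (β + 1) * t ^ (-β) * hdotNorm α γ f := by
  have hG : 0 < Real.Gamma (β + 1) := Real.Gamma_pos_of_pos (by linarith)
  have htβ := Real.rpow_pos_of_pos ht β
  rw [hdotNorm_eq, hdotNorm_eq]
  refine sqrt_tsum_sq_le (by positivity) (memHdot_iff.1 hf) fun n => ?_
  have he := eig_pos (α := α) (γ := γ) n
  have hx : 0 ≤ eig α γ n * t ^ β := by positivity
  have h1 := mul_mittagLeffler_neg_le hβ hβ1 hx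
  have h2 := mittagLeffler_neg_pos hβ hβ1 le_rfl hx
  rw [coeff_solCurve hβ hβ1 ht.le, neg_mul, ← mul_assoc, abs_mul, abs_mul, abs_mul,
    abs_of_pos he, abs_of_pos h2, Real.rpow_neg ht.le]
  have h3 : eig α γ n * mittagLeffler β 1 (-(eig α γ n * t ^ β))
      ≤ Real.Gamma (β + 1) * (t ^ β)⁻¹ := by
    rw [← div_eq_mul_inv, le_div_iff₀ htβ]
    linarith
  -- The decay estimate already absorbs the eigenvalue; `1 ≤ eig` merely weakens the `L²` norm of
  -- `f` to its `Ḣ^{α,γ}` norm.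
  exact mul_le_mul h3 (le_mul_of_one_le_left (abs_nonneg _) (one_le_eig hα hγ n))
    (abs_nonneg _) (by positivity)

theorem continuousOn_velCurve (hβ : 0 < β) (hβ1 : β ≤ 1) (hf : MemHdot α γ f) :
    ContinuousOn (velCurve β α γ f) (Ioi 0) := by
  intro t (ht : 0 < t)
  have hG := Real.Gamma_pos_of_pos hβ
  have hrc : ContinuousAt (fun s : ℝ => s ^ (β - 1)) t :=
    Real.continuousAt_rpow_const _ _ (Or.inl ht.ne')
  refine ContinuousAt.continuousWithinAt ?_
  refine tendsto_of_coeff (d := fun n => ((t ^ (β - 1) + 1) * (Real.Gamma β)⁻¹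
    + t ^ (β - 1) * (Real.Gamma β)⁻¹) * (eig α γ n * coeff f n)) ?_ ?_ fun n => ?_
  · simp_rw [mul_pow _ (eig α γ _ * coeff f _)]
    exact (memHdot_iff.1 hf).mul_left _
  · filter_upwards [Ioi_mem_nhds ht, hrc.eventually_lt_const (lt_add_one _)] with s hs hs' n
    have hs0 : 0 < s := hs
    have htp := Real.rpow_nonneg ht.le (β - 1)
    have hd : 0 ≤ (t ^ (β - 1) + 1) * (Real.Gamma β)⁻¹ + t ^ (β - 1) * (Real.Gamma β)⁻¹ := by
      positivity
    rw [coeff_velCurve hβ hβ1 hf ht.le, coeff_velCurve hβ hβ1 hf hs0.le,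
      abs_mul (_ + _), abs_of_nonneg hd, add_mul]
    refine (abs_sub _ _).trans (add_le_add ((abs_velCurve_coeff_le hβ hβ1 hs0.le n).trans ?_)
      (abs_velCurve_coeff_le hβ hβ1 ht.le n))
    gcongr
  · rw [coeff_velCurve hβ hβ1 hf ht.le]
    refine Tendsto.congr' (f₁ := fun s => s ^ (β - 1) *
      mittagLeffler β β (-eig α γ n * s ^ β) * (-(eig α γ n * coeff f n))) ?_ ?_
    · filter_upwards [Ioi_mem_nhds ht] with s hs
      rw [coeff_velCurve hβ hβ1 hf (le_of_lt hs)]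
    · exact (Tendsto.mul hrc
        ((continuous_mittagLeffler_mul_rpow hβ hβ _).tendsto t)).mul_const _

theorem aestronglyMeasurable_velCurve (hβ : 0 < β) (hβ1 : β ≤ 1) (hf : MemHdot α γ f) (t : ℝ) :
    AEStronglyMeasurable (velCurve β α γ f) (volume.restrict (Ioc 0 t)) :=
  ((continuousOn_velCurve hβ hβ1 hf).mono Ioc_subset_Ioi_self).aestronglyMeasurable
    measurableSet_Ioc

theorem intervalIntegrable_velCurve (hβ : 0 < β) (hβ1 : β ≤ 1) (hf : MemHdot α γ f) {s t : ℝ}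
    (hs : 0 ≤ s) (ht : 0 ≤ t) : IntervalIntegrable (velCurve β α γ f) volume s t := by
  have h0 : ∀ t, 0 ≤ t → IntervalIntegrable (velCurve β α γ f) volume 0 t := fun t ht => by
    have hi : IntervalIntegrable
        (fun r => r ^ (β - 1) * (Real.Gamma β)⁻¹ * hdotNorm α γ f) volume 0 t :=
      ((intervalIntegral.intervalIntegrable_rpow' (by linarith)).mul_const _).mul_const _
    rw [intervalIntegrable_iff_integrableOn_Ioc_of_le ht] at hi ⊢
    refine Integrable.mono' hi (aestronglyMeasurable_velCurve hβ hβ1 hf t) ?_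
    filter_upwards [ae_restrict_mem measurableSet_Ioc] with r hr
    exact norm_velCurve_le hβ hβ1 hf hr.1.le
  exact (h0 s hs).symm.trans (h0 t ht)

theorem solCurve_sub_eq_integral (hβ : 0 < β) (hβ1 : β ≤ 1) (hf : MemHdot α γ f) {s t : ℝ}
    (hs : 0 ≤ s) (ht : 0 ≤ t) :
    solCurve β α γ f t - solCurve β α γ f s = ∫ r in s..t, velCurve β α γ f r := by
  refine ext_coeff fun n => ?_
  rw [coeff_intervalIntegral (intervalIntegrable_velCurve hβ hβ1 hf hs ht), coeff_sub,
    coeff_solCurve hβ hβ1 ht, coeff_solCurve hβ hβ1 hs, ← sub_mul,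
    mittagLeffler_sub_eq_integral hβ hs ht, ← intervalIntegral.integral_mul_const]
  refine intervalIntegral.integral_congr fun r hr => ?_
  have hr0 : 0 ≤ r := (le_inf hs ht).trans hr.1
  rw [coeff_velCurve hβ hβ1 hf hr0]
  ring

theorem hasDerivAt_solCurve (hβ : 0 < β) (hβ1 : β ≤ 1) (hf : MemHdot α γ f) {t : ℝ}
    (ht : 0 < t) : HasDerivAt (solCurve β α γ f) (velCurve β α γ f t) t := by
  have hc := continuousOn_velCurve hβ hβ1 hf
  have h := (intervalIntegral.integral_hasDerivAt_right
    (intervalIntegrable_velCurve hβ hβ1 hf le_rfl ht.le)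
    (hc.stronglyMeasurableAtFilter isOpen_Ioi t ht)
    (hc.continuousAt (Ioi_mem_nhds ht))).const_add (solCurve β α γ f 0)
  refine h.congr_of_eventuallyEq ?_
  filter_upwards [Ioi_mem_nhds ht] with s hs
  rw [← solCurve_sub_eq_integral hβ hβ1 hf le_rfl (le_of_lt hs)]
  abel

theorem intervalIntegrable_sub_rpow_smul_velCurve (hβ : 0 < β) (hβ1 : β < 1)
    (hf : MemHdot α γ f) {t : ℝ} (ht : 0 < t) :
    IntervalIntegrable (fun s => (t - s) ^ (-β) • velCurve β α γ f s) volume 0 t := by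
  have hi := (intervalIntegrable_sub_rpow_mul_rpow (sub_pos.2 hβ1) hβ ht).mul_const
    ((Real.Gamma β)⁻¹ * hdotNorm α γ f)
  rw [intervalIntegrable_iff_integrableOn_Ioc_of_le ht.le] at hi ⊢
  refine Integrable.mono' hi (AEStronglyMeasurable.fun_smul
    (Measurable.aestronglyMeasurable (by fun_prop))
    (aestronglyMeasurable_velCurve hβ hβ1.le hf t)) ?_
  filter_upwards [ae_restrict_mem measurableSet_Ioc] with s hs
  have h1 := Real.rpow_nonneg (sub_nonneg.2 hs.2) (-β)
  rw [norm_smul, Real.norm_of_nonneg h1, sub_sub_cancel_left, mul_assoc]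
  refine mul_le_mul_of_nonneg_left ?_ h1
  rw [← mul_assoc]
  exact norm_velCurve_le hβ hβ1.le hf hs.1.le

/-- In each mode, the fractional integral of order `1 - β` turns `s^(β-1) E_{β,β}` into `E_{β,1}`,
because the index becomes `β + (1 - β) = 1`. -/
theorem fracOp_solCurve_eq_integral (hβ : 0 < β) (hβ1 : β < 1) (hf : MemHdot α γ f) {t : ℝ}
    (ht : 0 < t) :
    (Real.Gamma (1 - β))⁻¹ • ∫ s in (0 : ℝ)..t, (t - s) ^ (-β) • velCurve β α γ f s
      = fracOp α γ (solCurve β α γ f t) := by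
  refine ext_coeff fun n => ?_
  have hG := (Real.Gamma_pos_of_pos (sub_pos.2 hβ1)).ne'
  rw [coeff_smul, coeff_intervalIntegral (intervalIntegrable_sub_rpow_smul_velCurve hβ hβ1 hf ht),
    coeff_fracOp (memHdot_solCurve hβ hβ1.le hf ht.le), coeff_solCurve hβ hβ1.le ht.le]
  have e : ∫ s in (0 : ℝ)..t, coeff ((t - s) ^ (-β) • velCurve β α γ f s) n
      = (∫ s in (0 : ℝ)..t, (t - s) ^ ((1 - β) - 1) *
        (s ^ (β - 1) * mittagLeffler β β (-eig α γ n * s ^ β))) * (-(eig α γ n * coeff f n)) := by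
    rw [← intervalIntegral.integral_mul_const]
    refine intervalIntegral.integral_congr fun s hs => ?_
    rw [uIcc_of_le ht.le] at hs
    rw [coeff_smul, coeff_velCurve hβ hβ1.le hf hs.1, sub_sub_cancel_left]
    ring
  rw [e, integral_sub_rpow_mul_mittagLeffler hβ hβ (sub_pos.2 hβ1) ht]
  have e2 : β + (1 - β) = 1 := by ring
  rw [e2, sub_self, Real.rpow_zero]
  field_simp

end Curves

/-! ### Representatives of a curve in `L²(D)` that converge almost everywhere at time zero -/

/-- Required for monotonicity of Bochner integrals with values in the lattice `L²(D)`. -/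
theorem isOrderedModule_L2D : IsOrderedModule ℝ L2D where
  smul_le_smul_of_nonneg_left c hc v w hvw := by
    rw [← Lp.coeFn_le] at hvw ⊢
    filter_upwards [hvw, Lp.coeFn_smul c v, Lp.coeFn_smul c w] with x hx h1 h2
    rw [h1, h2]
    exact mul_le_mul_of_nonneg_left hx hc
  smul_le_smul_of_nonneg_right v hv c d hcd := by
    rw [← Lp.coeFn_le] at hv ⊢
    filter_upwards [hv, Lp.coeFn_zero ℝ 2 measD, Lp.coeFn_smul c v, Lp.coeFn_smul d v]
      with x hx h0 h1 h2
    rw [h1, h2]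
    rw [h0] at hx
    exact mul_le_mul_of_nonneg_right hcd hx

theorem intervalIntegrable_abs {V : ℝ → L2D} {a b : ℝ} (hV : IntervalIntegrable V volume a b) :
    IntervalIntegrable (fun s => |V s|) volume a b := by
  have hc : Continuous fun v : L2D => |v| := continuous_id.sup continuous_neg
  exact ⟨Integrable.mono hV.1 (hc.comp_aestronglyMeasurable hV.1.1)
      (ae_of_all _ fun s => (norm_abs_eq_norm _).le),
    Integrable.mono hV.2 (hc.comp_aestronglyMeasurable hV.2.1)
      (ae_of_all _ fun s => (norm_abs_eq_norm _).le)⟩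

theorem abs_integral_le_integral_abs_L2D {V : ℝ → L2D} {a b : ℝ} (hab : a ≤ b)
    (hV : IntervalIntegrable V volume a b) :
    |∫ s in a..b, V s| ≤ ∫ s in a..b, |V s| := by
  have := isOrderedModule_L2D
  have hA := intervalIntegrable_abs hV
  simp_rw [intervalIntegral.integral_of_le hab]
  rw [abs_le']
  refine ⟨integral_mono hV.1 hA.1 fun s => le_abs_self _, ?_⟩
  rw [← integral_neg]
  exact integral_mono hV.1.neg hA.1 fun s => neg_le_abs _

theorem integral_abs_mono_L2D {V : ℝ → L2D} {a b c : ℝ} (hab : a ≤ b) (hbc : b ≤ c)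
    (hV : IntervalIntegrable V volume a c) :
    ∫ s in a..b, |V s| ≤ ∫ s in a..c, |V s| := by
  have := isOrderedModule_L2D
  have hA := intervalIntegrable_abs hV
  have h1 : IntervalIntegrable (fun s => |V s|) volume a b := hA.mono_set (by
    rw [uIcc_of_le hab, uIcc_of_le (hab.trans hbc)]; exact Icc_subset_Icc_right hbc)
  have h2 : IntervalIntegrable (fun s => |V s|) volume b c := hA.mono_set (by
    rw [uIcc_of_le hbc, uIcc_of_le (hab.trans hbc)]; exact Icc_subset_Icc_left hab)
  rw [← intervalIntegral.integral_add_adjacent_intervals h1 h2,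
    intervalIntegral.integral_of_le hbc]
  exact le_add_of_nonneg_right (integral_nonneg fun s => abs_nonneg _)

theorem exists_representative {U V : ℝ → L2D} {T : ℝ} (hT : 0 < T)
    (hV : IntervalIntegrable V volume 0 T)
    (hU : ∀ t ∈ Ioc 0 T, U t - U 0 = ∫ s in (0 : ℝ)..t, V s) :
    ∃ u : ℝ → ℝ → ℝ, (∀ t, u t =ᵐ[measD] U t) ∧ (∀ t, u t (-1) = 0 ∧ u t 1 = 0) ∧
      ∀ᵐ x ∂measD, Tendsto (fun t => u t x) (𝓝[>] 0) (𝓝 (U 0 x)) := by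
  set H : ℝ → L2D := fun t => ∫ s in (0 : ℝ)..t, |V s| with hH
  have hHc : ContinuousOn H (Icc 0 T) := by
    have := intervalIntegral.continuousOn_primitive_interval' (intervalIntegrable_abs hV)
      left_mem_uIcc
    rwa [uIcc_of_le hT.le] at this
  have hseq : Tendsto (fun k : ℕ => T / ((k : ℝ) + 1)) atTop (𝓝 0) := by
    simpa [div_eq_mul_inv] using (tendsto_one_div_add_atTop_nhds_zero_nat (𝕜 := ℝ)).const_mul T
  have hmem : ∀ k : ℕ, T / ((k : ℝ) + 1) ∈ Ioc 0 T := fun k =>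
    ⟨by positivity, div_le_self hT.le (by linarith [k.cast_nonneg (α := ℝ)])⟩
  have hlim : Tendsto (fun k : ℕ => H (T / ((k : ℝ) + 1))) atTop (𝓝 0) := by
    have h := (hHc 0 (left_mem_Icc.2 hT.le)).tendsto.comp (tendsto_nhdsWithin_iff.2
      ⟨hseq, Eventually.of_forall fun k => Ioc_subset_Icc_self (hmem k)⟩)
    simpa [hH, Function.comp_def] using h
  obtain ⟨ns, -, hns⟩ := (tendstoInMeasure_of_tendsto_Lp hlim).exists_seq_tendsto_ae
  set τ : ℕ → ℝ := fun j => T / ((ns j : ℝ) + 1) with hτ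
  have hτm : ∀ j, τ j ∈ Ioc 0 T := fun j => hmem _
  -- For fixed `t > 0` this holds for a.e. `x`, with the bound `H (τ j)` independent of `t`. Along
  -- the chosen subsequence `H (τ j)` tends to `0` a.e.
  let P : ℝ → ℝ → Prop := fun t x => ∀ j, t ≤ τ j → |U t x - U 0 x| ≤ H (τ j) x
  have hP : ∀ t, 0 < t → ∀ᵐ x ∂measD, P t x := by
    intro t ht
    rw [ae_all_iff]
    intro j
    by_cases htj : t ≤ τ j
    · have htT : t ≤ T := htj.trans (hτm j).2
      have hV' : IntervalIntegrable V volume 0 (τ j) := hV.mono_set (by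
        rw [uIcc_of_le (hτm j).1.le, uIcc_of_le hT.le]; exact Icc_subset_Icc_right (hτm j).2)
      have hVt : IntervalIntegrable V volume 0 t := hV.mono_set (by
        rw [uIcc_of_le ht.le, uIcc_of_le hT.le]; exact Icc_subset_Icc_right htT)
      have hle : |U t - U 0| ≤ H (τ j) := by
        rw [hU t ⟨ht, htT⟩]
        exact (abs_integral_le_integral_abs_L2D ht.le hVt).trans
          (integral_abs_mono_L2D ht.le htj hV')
      filter_upwards [(Lp.coeFn_le _ _).2 hle, Lp.coeFn_abs (U t - U 0),
        Lp.coeFn_sub (U t) (U 0)] with x h1 h2 h3 _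
      rw [h2, h3] at h1
      exact h1
    · exact ae_of_all _ fun x h => absurd h htj
  have hnonneg : ∀ᵐ x ∂measD, ∀ j, 0 ≤ H (τ j) x := by
    filter_upwards [ae_all_iff.2 fun j => hP (τ j) (hτm j).1] with x hx j
    exact (abs_nonneg _).trans (hx j j le_rfl)
  classical
  -- The null set where `P t` fails depends on `t`, and uncountably many such sets need not have
  -- null union. Substituting `U 0 x` there changes no class and makes the bound hold for every
  -- small `t`.
  refine ⟨fun t x => if x = -1 ∨ x = 1 then 0 else if 0 < t ∧ ¬ P t x then U 0 x else U t x,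
    fun t => ?_, fun t => by simp, ?_⟩
  · have h : ∀ᵐ x ∂measD, ¬ (0 < t ∧ ¬ P t x) := by
      by_cases ht : 0 < t
      · filter_upwards [hP t ht] with x hx h using h.2 hx
      · exact ae_of_all _ fun x h => ht h.1
    filter_upwards [h, ae_restrict_mem measurableSet_Ioo] with x hx hxD
    rw [if_neg (by rintro (h | h) <;> simp [h] at hxD), if_neg hx]
  · filter_upwards [hns, hnonneg, ae_restrict_mem measurableSet_Ioo, Lp.coeFn_zero ℝ 2 measD]
      with x hx hx0 hxD hz
    rw [hz] at hx
    rw [Metric.tendsto_nhds]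
    intro ε hε
    obtain ⟨j, hj⟩ := (hx.eventually_lt_const hε).exists
    filter_upwards [Ioo_mem_nhdsGT (hτm j).1] with t ht
    rw [if_neg (by rintro (h | h) <;> simp [h] at hxD), Real.dist_eq]
    refine lt_of_le_of_lt ?_ hj
    split_ifs with h
    · simpa using hx0 j
    · have hPt : P t x := by
        by_contra hc
        exact h ⟨ht.1, hc⟩
      exact hPt j ht.2.le

/-! ### Uniqueness -/

theorem lt_sub_rpow_neg_iff {β s t y : ℝ} (hβ : 0 < β) (hst : s < t) (hy : 0 < y) :
    y < (t - s) ^ (-β) ↔ t - y ^ (-β)⁻¹ < s := by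
  rw [← Real.lt_rpow_inv_iff_of_neg (sub_pos.2 hst) hy (neg_neg_of_pos hβ), sub_lt_comm]

theorem integral_indicator_Iio {c φ : ℝ} (hφ : 0 ≤ φ) :
    ∫ y in Ioi (0 : ℝ), (Iio φ).indicator (fun _ => c) y = φ * c := by
  rw [integral_indicator measurableSet_Iio, Measure.restrict_restrict measurableSet_Iio,
    inter_comm, Ioi_inter_Iio, setIntegral_const]
  simp [hφ]

/-- If all the integrals of `g` over `(s, t)` are nonnegative, so is its integral against the
increasing weight `(t - s) ^ (-β)`. -/
theorem integral_sub_rpow_mul_nonneg {β t : ℝ} {g : ℝ → ℝ} (hβ : 0 < β) (ht : 0 < t)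
    (hg : IntervalIntegrable g volume 0 t)
    (hi : IntervalIntegrable (fun s => (t - s) ^ (-β) * g s) volume 0 t)
    (h : ∀ s ∈ Icc 0 t, 0 ≤ ∫ r in s..t, g r) :
    0 ≤ ∫ s in (0 : ℝ)..t, (t - s) ^ (-β) * g s := by
  rw [intervalIntegrable_iff_integrableOn_Ioo_of_le ht.le] at hg hi
  -- Layer-cake: the weight is the length of `(0, (t-s)^(-β))`. After Fubini, each level `y` selects
  -- an interval ending at `t`, since the weight increases in `s`.
  set F : ℝ → ℝ → ℝ := fun s y => (Iio ((t - s) ^ (-β))).indicator (fun _ => g s) y with hF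
  have hφ : ∀ s ∈ Ioo 0 t, 0 ≤ (t - s) ^ (-β) := fun s hs =>
    Real.rpow_nonneg (sub_nonneg.2 hs.2.le) _
  have hS : MeasurableSet {p : ℝ × ℝ | p.2 < (t - p.1) ^ (-β)} :=
    measurableSet_lt (by fun_prop) (by fun_prop)
  have hmeas : AEStronglyMeasurable (Function.uncurry F)
      ((volume.restrict (Ioo 0 t)).prod (volume.restrict (Ioi 0))) := by
    have h1 := (hg.1.comp_fst (ν := volume.restrict (Ioi (0 : ℝ)))).indicator hS
    refine h1.congr (ae_of_all _ fun p => ?_)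
    simp only [hF, Function.uncurry, indicator_apply, mem_ofPred_eq, mem_Iio]
  have hint : Integrable (Function.uncurry F)
      ((volume.restrict (Ioo 0 t)).prod (volume.restrict (Ioi 0))) := by
    rw [integrable_prod_iff hmeas]
    constructor
    · refine ae_of_all _ fun s => ?_
      change Integrable ((Iio ((t - s) ^ (-β))).indicator fun _ => g s) (volume.restrict (Ioi 0))
      rw [integrable_indicator_iff measurableSet_Iio, IntegrableOn,
        Measure.restrict_restrict measurableSet_Iio, inter_comm, Ioi_inter_Iio]
      exact integrable_const _
    · refine hi.norm.congr ?_
      filter_upwards [ae_restrict_mem measurableSet_Ioo] with s hs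
      have e : ∀ y, ‖Function.uncurry F (s, y)‖
          = (Iio ((t - s) ^ (-β))).indicator (fun _ => ‖g s‖) y := fun y => by
        simp only [hF, Function.uncurry, norm_indicator_eq_indicator_norm]
      simp_rw [e]
      rw [integral_indicator_Iio (hφ s hs), norm_mul, Real.norm_of_nonneg (hφ s hs)]
  have e1 : ∫ s in (0 : ℝ)..t, (t - s) ^ (-β) * g s
      = ∫ s in Ioo 0 t, ∫ y in Ioi (0 : ℝ), F s y := by
    rw [intervalIntegral.integral_of_le ht.le, integral_Ioc_eq_integral_Ioo]
    refine setIntegral_congr_fun measurableSet_Ioo fun s hs => ?_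
    rw [hF, integral_indicator_Iio (hφ s hs)]
  rw [e1, integral_integral_swap hint]
  refine setIntegral_nonneg measurableSet_Ioi fun y (hy : 0 < y) => ?_
  set a := max 0 (min t (t - y ^ (-β)⁻¹)) with ha
  have hyp : 0 < y ^ (-β)⁻¹ := Real.rpow_pos_of_pos hy _
  have ha0 : 0 ≤ a := le_max_left _ _
  have hat : a ≤ t := max_le ht.le (min_le_left _ _)
  have e2 : ∫ s in Ioo 0 t, F s y = ∫ r in a..t, g r := by
    have e3 : ∀ s ∈ Ioo 0 t, F s y = (Ioo a t).indicator g s := by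
      intro s hs
      have hiff : s ∈ Ioo a t ↔ y < (t - s) ^ (-β) := by
        rw [lt_sub_rpow_neg_iff hβ hs.2 hy, min_eq_right (by linarith)] at *
        simp [ha, hs.1, hs.2]
      simp only [hF, indicator_apply, mem_Iio, hiff]
    rw [setIntegral_congr_fun measurableSet_Ioo e3, integral_indicator measurableSet_Ioo,
      Measure.restrict_restrict measurableSet_Ioo,
      inter_eq_left.2 (Ioo_subset_Ioo_left ha0), intervalIntegral.integral_of_le hat,
      integral_Ioc_eq_integral_Ioo]
  rw [e2]
  exact h a ⟨ha0, hat⟩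

/-- Multiplying back by the continuous function `(t - s)^β` removes the kernel; thus convergence of
the Caputo integral forces integrability of the derivative up to time zero. -/
theorem intervalIntegrable_of_sub_rpow_smul {E : Type*} [NormedAddCommGroup E]
    [NormedSpace ℝ E] {β t : ℝ} {g : ℝ → E} (hβ : 0 < β) (ht : 0 < t)
    (hi : IntervalIntegrable (fun s => (t - s) ^ (-β) • g s) volume 0 t) :
    IntervalIntegrable g volume 0 t := by
  have hc : Continuous fun s : ℝ => (t - s) ^ β :=
    (continuous_const.sub continuous_id).rpow_const fun _ => Or.inr hβ.le
  have h := hi.continuousOn_smul hc.continuousOn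
  rw [intervalIntegrable_iff_integrableOn_Ioo_of_le ht.le] at h ⊢
  refine h.congr_fun (fun s hs => ?_) measurableSet_Ioo
  have hp : 0 < t - s := sub_pos.2 hs.2
  simp only
  rw [smul_smul, ← Real.rpow_add hp, add_neg_cancel, Real.rpow_zero, one_smul]

theorem tendsto_primitive_nhdsGT_zero {E : Type*} [NormedAddCommGroup E] [NormedSpace ℝ E]
    {T : ℝ} {q g : ℝ → E} (hT : 0 < T) (hg : IntervalIntegrable g volume 0 T)
    (hq : ∀ a b : ℝ, 0 < a → a ≤ b → b ≤ T → q b - q a = ∫ s in a..b, g s) :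
    Tendsto q (𝓝[>] 0) (𝓝 (q T - ∫ s in (0 : ℝ)..T, g s)) := by
  have hc := intervalIntegral.continuousOn_primitive_interval_left
    ((intervalIntegrable_iff' (μ := volume)).1 hg)
  rw [uIcc_of_le hT.le] at hc
  have h0 := (hc 0 (left_mem_Icc.2 hT.le)).mono_left (nhdsWithin_mono _ (Ioc_subset_Icc_self))
  rw [nhdsWithin_Ioc_eq_nhdsGT hT] at h0
  refine (h0.const_sub (q T)).congr' ?_
  filter_upwards [Ioc_mem_nhdsGT hT] with a ha
  rw [← hq a T ha.1 ha.2 le_rfl, sub_sub_cancel]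

/-- A maximum principle for fractional relaxation equations. -/
theorem nonpos_of_fractional_relaxation {β T c : ℝ} {w g : ℝ → ℝ} (hβ : 0 < β) (hc : 0 < c)
    (hw : ∀ a b : ℝ, 0 < a → a ≤ b → b ≤ T → w b - w a = ∫ s in a..b, g s)
    (hi : ∀ t ∈ Ioc 0 T, IntervalIntegrable (fun s => (t - s) ^ (-β) * g s) volume 0 t)
    (he : ∀ t ∈ Ioc 0 T, ∫ s in (0 : ℝ)..t, (t - s) ^ (-β) * g s = -(c * w t))
    (h0 : Tendsto w (𝓝[>] 0) (𝓝 0)) : ∀ t ∈ Ioc 0 T, w t ≤ 0 := by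
  intro t₁ ht₁
  have hT : 0 < T := ht₁.1.trans_le ht₁.2
  have hg : ∀ t ∈ Ioc 0 T, IntervalIntegrable g volume 0 t := fun t ht =>
    intervalIntegrable_of_sub_rpow_smul hβ ht.1 (hi t ht)
  -- `W` extends `w` continuously to time zero with value `0`, so a positive maximum is attained at
  -- a positive time.
  set W : ℝ → ℝ := fun t => ∫ s in (0 : ℝ)..t, g s with hW
  have hWw : ∀ t ∈ Ioc 0 T, W t = w t := by
    intro t ht
    have h := tendsto_nhds_unique h0 (tendsto_primitive_nhdsGT_zero ht.1 (hg t ht)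
      fun a b ha hab hb => hw a b ha hab (hb.trans ht.2))
    rw [hW]
    linarith
  have hWc : ContinuousOn W (Icc 0 T) := by
    have := intervalIntegral.continuousOn_primitive_interval' (hg T ⟨hT, le_rfl⟩) left_mem_uIcc
    rwa [uIcc_of_le hT.le] at this
  by_contra hpos
  obtain ⟨t, ht, hmax⟩ := isCompact_Icc.exists_isMaxOn (nonempty_Icc.2 hT.le) hWc
  have hWt : 0 < W t := by
    have := hmax (Ioc_subset_Icc_self ht₁)
    simp only [mem_ofPred_eq, hWw t₁ ht₁] at this
    linarith [not_le.1 hpos]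
  have htpos : 0 < t := by
    refine lt_of_le_of_ne ht.1 ?_
    rintro rfl
    simp [hW] at hWt
  have htm : t ∈ Ioc 0 T := ⟨htpos, ht.2⟩
  -- The integral of `g` from `s` to `t` is `W t - W s`, nonnegative because `t` is a maximum.
  have hnn := integral_sub_rpow_mul_nonneg hβ htpos (hg t htm) (hi t htm) fun s hs => by
    have hs0 : IntervalIntegrable g volume 0 s := (hg t htm).mono_set (by
      rw [uIcc_of_le hs.1, uIcc_of_le ht.1]; exact Icc_subset_Icc_right hs.2)
    rw [← intervalIntegral.integral_interval_sub_left (hg t htm) hs0, sub_nonneg]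
    exact hmax ⟨hs.1, hs.2.trans ht.2⟩
  rw [he t htm, ← hWw t htm] at hnn
  nlinarith

theorem eq_zero_of_fractional_relaxation {β T c : ℝ} {w g : ℝ → ℝ} (hβ : 0 < β) (hc : 0 < c)
    (hw : ∀ a b : ℝ, 0 < a → a ≤ b → b ≤ T → w b - w a = ∫ s in a..b, g s)
    (hi : ∀ t ∈ Ioc 0 T, IntervalIntegrable (fun s => (t - s) ^ (-β) * g s) volume 0 t)
    (he : ∀ t ∈ Ioc 0 T, ∫ s in (0 : ℝ)..t, (t - s) ^ (-β) * g s = -(c * w t))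
    (h0 : Tendsto w (𝓝[>] 0) (𝓝 0)) : ∀ t ∈ Ioc 0 T, w t = 0 := by
  intro t ht
  refine le_antisymm (nonpos_of_fractional_relaxation hβ hc hw hi he h0 t ht) ?_
  have h := nonpos_of_fractional_relaxation (w := fun t => -w t) (g := fun s => -g s) hβ hc
    (fun a b ha hab hb => by
      rw [intervalIntegral.integral_neg, ← hw a b ha hab hb]; ring)
    (fun t ht => by simp_rw [mul_neg]; exact (hi t ht).neg)
    (fun t ht => by
      simp_rw [mul_neg]
      rw [intervalIntegral.integral_neg, he t ht])
    (by simpa using h0.neg) t ht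
  linarith

/-! ### Functions, their `L²` classes, and uniqueness of weak solutions -/

theorem coeFn_toL2 {g : ℝ → ℝ} (hg : MemLp g 2 measD) : toL2 g =ᵐ[measD] g := by
  rw [toL2, dif_pos hg]
  exact hg.coeFn_toLp

theorem toL2_eq_of_ae {g : ℝ → ℝ} {v : L2D} (h : g =ᵐ[measD] v) : toL2 g = v := by
  have hg : MemLp g 2 measD := (memLp_congr_ae h).2 (Lp.memLp v)
  exact Lp.ext ((coeFn_toL2 hg).trans h)

/-- Along a sequence of times, `L²` convergence yields an a.e. convergent subsequence, and only
countably many null sets intervene. This turns the pointwise initial condition into one on Fourier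
coefficients. -/
theorem eq_of_tendsto_of_tendsto_ae {T : ℝ} (hT : 0 < T) {v : ℝ → ℝ → ℝ} {f q : L2D}
    (hv : ∀ t ∈ Ioc 0 T, MemLp (v t) 2 measD)
    (hq : Tendsto (fun t => toL2 (v t)) (𝓝[>] 0) (𝓝 q))
    (hf : ∀ᵐ x ∂measD, Tendsto (fun t => v t x) (𝓝[>] 0) (𝓝 (f x))) : q = f := by
  set τ : ℕ → ℝ := fun k => T / ((k : ℝ) + 1) with hτ
  have hτm : ∀ k, τ k ∈ Ioc 0 T := fun k =>
    ⟨by positivity, div_le_self hT.le (by linarith [k.cast_nonneg (α := ℝ)])⟩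
  have hτ0 : Tendsto τ atTop (𝓝[>] 0) := by
    refine tendsto_nhdsWithin_iff.2 ⟨?_, Eventually.of_forall fun k => (hτm k).1⟩
    simpa [hτ, div_eq_mul_inv] using
      (tendsto_one_div_add_atTop_nhds_zero_nat (𝕜 := ℝ)).const_mul T
  obtain ⟨ns, hmono, hns⟩ :=
    (tendstoInMeasure_of_tendsto_Lp (hq.comp hτ0)).exists_seq_tendsto_ae
  refine Lp.ext ?_
  filter_upwards [hns, hf, ae_all_iff.2 fun k => coeFn_toL2 (hv _ (hτm k))] with x h1 h2 h3
  refine tendsto_nhds_unique h1 ?_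
  refine (h2.comp (hτ0.comp hmono.tendsto_atTop)).congr fun k => ?_
  exact (h3 (ns k)).symm

namespace IsWeakSolution

variable {β α γ T : ℝ} {f : L2D} {u v : ℝ → ℝ → ℝ}

theorem tendsto_initial (hβ : 0 < β) (hT : 0 < T) (hu : IsWeakSolution β α γ T f u) :
    Tendsto (fun t => toL2 (u t)) (𝓝[>] 0) (𝓝 f) := by
  have h := tendsto_primitive_nhdsGT_zero hT
    (intervalIntegrable_of_sub_rpow_smul hβ hT (hu.hasCaputo.integrable T ⟨hT, le_rfl⟩))
    fun a b ha hab hb => (hu.hasCaputo.locallyAC a b ha hab hb).2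
  have e := eq_of_tendsto_of_tendsto_ae hT hu.memLp h hu.initial
  rwa [e] at h

theorem integral_coeff_deriv (hβ1 : β < 1) (hu : IsWeakSolution β α γ T f u) (n : ℕ) {t : ℝ}
    (ht : t ∈ Ioc 0 T) :
    ∫ s in (0 : ℝ)..t, (t - s) ^ (-β) * coeff (deriv (fun s => toL2 (u s)) s) n
      = -(Real.Gamma (1 - β) * (eig α γ n * coeff (toL2 (u t)) n)) := by
  have hG := (Real.Gamma_pos_of_pos (sub_pos.2 hβ1)).ne'
  have h := congrArg (fun v => coeff v n) (hu.equation t ht)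
  simp only [caputoDeriv, coeff_smul, coeff_fracOp (hu.memHdot t ht),
    coeff_intervalIntegral (hu.hasCaputo.integrable t ht)] at h
  rw [inv_mul_eq_iff_eq_mul₀ hG] at h
  rw [h]
  ring

/-- Each Fourier coefficient of the difference solves a scalar relaxation equation with zero initial
value. -/
theorem toL2_eq (hβ : 0 < β) (hβ1 : β < 1) (hu : IsWeakSolution β α γ T f u)
    (hv : IsWeakSolution β α γ T f v) {t : ℝ} (ht : t ∈ Ioc 0 T) :
    toL2 (v t) = toL2 (u t) := by
  have hT : 0 < T := ht.1.trans_le ht.2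
  refine ext_coeff fun n => sub_eq_zero.1 ?_
  have hi : ∀ {w : ℝ → ℝ → ℝ}, IsWeakSolution β α γ T f w → ∀ t ∈ Ioc 0 T, IntervalIntegrable
      (fun s => (t - s) ^ (-β) * coeff (deriv (fun s => toL2 (w s)) s) n) volume 0 t := by
    intro w hw t ht
    simpa only [coeff_smul] using intervalIntegrable_coeff (hw.hasCaputo.integrable t ht) n
  refine eq_zero_of_fractional_relaxation
    (w := fun t => coeff (toL2 (v t)) n - coeff (toL2 (u t)) n)
    (g := fun s => coeff (deriv (fun s => toL2 (v s)) s) n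
      - coeff (deriv (fun s => toL2 (u s)) s) n)
    (c := Real.Gamma (1 - β) * eig α γ n) hβ
    (mul_pos (Real.Gamma_pos_of_pos (sub_pos.2 hβ1)) (eig_pos n)) ?_ ?_ ?_ ?_ t ht
  · intro a b ha hab hb
    obtain ⟨hu1, hu2⟩ := hu.hasCaputo.locallyAC a b ha hab hb
    obtain ⟨hv1, hv2⟩ := hv.hasCaputo.locallyAC a b ha hab hb
    rw [intervalIntegral.integral_sub (intervalIntegrable_coeff hv1 n)
      (intervalIntegrable_coeff hu1 n), ← coeff_intervalIntegral hv1,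
      ← coeff_intervalIntegral hu1, ← hu2, ← hv2, coeff_sub, coeff_sub]
    ring
  · intro t ht
    simp_rw [mul_sub]
    exact (hi hv t ht).sub (hi hu t ht)
  · intro t ht
    simp_rw [mul_sub]
    rw [intervalIntegral.integral_sub (hi hv t ht) (hi hu t ht),
      hu.integral_coeff_deriv hβ1 n ht, hv.integral_coeff_deriv hβ1 n ht]
    ring
  · have h1 := ((continuous_coeff n).tendsto f).comp (hu.tendsto_initial hβ hT)
    have h2 := ((continuous_coeff n).tendsto f).comp (hv.tendsto_initial hβ hT)
    simpa using h2.sub h1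

theorem ae_eq (hβ : 0 < β) (hβ1 : β < 1) (hu : IsWeakSolution β α γ T f u)
    (hv : IsWeakSolution β α γ T f v) {t : ℝ} (ht : t ∈ Ioc 0 T) : v t =ᵐ[measD] u t := by
  have h := hu.toL2_eq hβ hβ1 hv ht
  refine (coeFn_toL2 (hv.memLp t ht)).symm.trans ?_
  rw [h]
  exact coeFn_toL2 (hu.memLp t ht)

end IsWeakSolution

/-! ### Existence -/

theorem psiFun_neg_one (n : ℕ) : psiFun n (-1) = 0 := by simp [psiFun]

theorem psiFun_one (n : ℕ) : psiFun n 1 = 0 := by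
  have : ((n : ℝ) + 1) * Real.pi / 2 * (1 + 1) = ((n + 1 : ℕ) : ℝ) * Real.pi := by
    push_cast; ring
  rw [psiFun, this, Real.sin_nat_mul_pi]

theorem toL2_sum_psiFun (s : Finset ℕ) (c : ℕ → ℝ) :
    toL2 (fun x => ∑ k ∈ s, c k * psiFun k x) = ∑ k ∈ s, c k • psi k := by
  refine toL2_eq_of_ae ?_
  have h : ∀ᵐ x ∂measD, ∀ k, (c k • psi k : L2D) x = c k * psiFun k x := by
    refine ae_all_iff.2 fun k => ?_
    filter_upwards [Lp.coeFn_smul (c k) (psi k), (memLp_psiFun k).coeFn_toLp] with x h1 h2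
    rw [h1, Pi.smul_apply, smul_eq_mul, psi, h2]
  filter_upwards [h, Lp.coeFn_finsetSum s fun k => c k • psi k] with x h1 h2
  rw [h2, Finset.sum_apply]
  exact Finset.sum_congr rfl fun k _ => (h1 k).symm

/-- Partial sums of the sine series vanish at the endpoints and converge in `Ḣ^{α,γ}`. -/
theorem zeroOnBoundary_of_memHdot {α γ : ℝ} {v : L2D} (hv : MemHdot α γ v) :
    ZeroOnBoundary α γ v := by
  intro ε hε
  set S : ℕ → L2D := fun N => ∑ k ∈ Finset.range N, coeff v k • psi k with hS
  have hc : ∀ N n, coeff (v - S N) n = if n < N then 0 else coeff v n := by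
    intro N n
    rw [coeff_sub, hS, coeff_sum_smul_psi]
    simp only [Finset.mem_range]
    split_ifs <;> simp
  have hle : ∀ N n, |eig α γ n * coeff (v - S N) n| ≤ |eig α γ n * coeff v n| := by
    intro N n
    rw [hc]
    split_ifs
    · rw [mul_zero, abs_zero]
      exact abs_nonneg _
    · exact le_rfl
  have hlim : Tendsto (fun N => hdotNorm α γ (v - S N)) atTop (𝓝 0) := by
    simp_rw [hdotNorm_eq]
    refine tendsto_sqrt_tsum_sq (memHdot_iff.1 hv) (Eventually.of_forall hle) fun n => ?_
    refine tendsto_const_nhds.congr' ?_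
    filter_upwards [eventually_gt_atTop n] with N hN
    rw [hc, if_pos hN, mul_zero]
  obtain ⟨N, hN⟩ := (hlim.eventually_lt_const hε).exists
  refine ⟨fun x => ∑ k ∈ Finset.range N, coeff v k * psiFun k x, ?_, ?_, ?_, ?_, ?_⟩
  · exact (continuous_finsetSum _ fun k _ =>
      continuous_const.mul (continuous_psiFun k)).continuousOn
  · simp [psiFun_neg_one]
  · simp [psiFun_one]
  · rw [toL2_sum_psiFun, memHdot_iff]
    refine summable_sq_of_abs_le (memHdot_iff.1 hv) fun n => ?_
    rw [coeff_sum_smul_psi]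
    split_ifs
    · exact le_rfl
    · rw [mul_zero, abs_zero]
      exact abs_nonneg _
  · rw [toL2_sum_psiFun]
    exact hN

section Existence

variable {β α γ : ℝ} {f : L2D}

theorem caputoDeriv_solCurve (hβ : 0 < β) (hβ1 : β < 1) (hf : MemHdot α γ f) {t : ℝ}
    (ht : 0 < t) :
    caputoDeriv β (solCurve β α γ f) t = fracOp α γ (solCurve β α γ f t) := by
  rw [← fracOp_solCurve_eq_integral hβ hβ1 hf ht, caputoDeriv]
  congr 1
  -- The velocity is identified with the derivative only at positive times; endpoints do not affect
  -- the integral.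
  refine intervalIntegral.integral_congr_uIoo fun s hs => ?_
  rw [uIoo_of_le ht.le] at hs
  rw [(hasDerivAt_solCurve hβ hβ1.le hf hs.1).deriv]

theorem hasCaputo_solCurve (hβ : 0 < β) (hβ1 : β < 1) (hf : MemHdot α γ f) (T : ℝ) :
    HasCaputo β T (solCurve β α γ f) := by
  have hd : ∀ {s : ℝ}, 0 < s → deriv (solCurve β α γ f) s = velCurve β α γ f s := fun hs =>
    (hasDerivAt_solCurve hβ hβ1.le hf hs).deriv
  refine ⟨fun a b ha hab _ => ?_, fun t ht => ?_⟩
  · have heq : EqOn (velCurve β α γ f) (deriv (solCurve β α γ f)) (uIcc a b) := fun s hs => by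
      rw [uIcc_of_le hab] at hs
      exact (hd (ha.trans_le hs.1)).symm
    rw [solCurve_sub_eq_integral hβ hβ1.le hf ha.le (ha.le.trans hab)]
    exact ⟨(intervalIntegrable_velCurve hβ hβ1.le hf ha.le (ha.le.trans hab)).congr
      (heq.mono uIoc_subset_uIcc), intervalIntegral.integral_congr heq⟩
  · refine (intervalIntegrable_sub_rpow_smul_velCurve hβ hβ1 hf ht.1).congr fun s hs => ?_
    rw [uIoc_of_le ht.1.le] at hs
    rw [hd hs.1]

theorem exists_isWeakSolution (hβ : 0 < β) (hβ1 : β < 1) (hf : MemHdot α γ f) (T : ℝ) :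
    ∃ u : ℝ → ℝ → ℝ, IsWeakSolution β α γ T f u ∧ ∀ t, u t =ᵐ[measD] solCurve β α γ f t := by
  -- The horizon `1` is arbitrary: only small times matter for the initial limit.
  obtain ⟨u, hu, hub, hu0⟩ := exists_representative one_pos
    (intervalIntegrable_velCurve hβ hβ1.le hf le_rfl zero_le_one)
    fun t ht => solCurve_sub_eq_integral hβ hβ1.le hf le_rfl ht.1.le
  have hL : (fun t => toL2 (u t)) = solCurve β α γ f := funext fun t => toL2_eq_of_ae (hu t)
  have hL' : ∀ t, toL2 (u t) = solCurve β α γ f t := fun t => congrFun hL t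
  rw [solCurve_zero hβ hβ1.le] at hu0
  refine ⟨u, ⟨fun t _ => (memLp_congr_ae (hu t)).2 (Lp.memLp _), fun t ht => ?_,
    fun t _ => hub t, fun t ht => ?_, hu0, ?_, fun t ht => ?_⟩, hu⟩
  · rw [hL']
    exact memHdot_solCurve hβ hβ1.le hf ht.1.le
  · rw [hL']
    exact zeroOnBoundary_of_memHdot (memHdot_solCurve hβ hβ1.le hf ht.1.le)
  · rw [hL]
    exact hasCaputo_solCurve hβ hβ1 hf T
  · rw [hL, hL']
    exact caputoDeriv_solCurve hβ hβ1 hf ht.1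

end Existence

end DoubleScale

/-! ### The main theorem -/

open DoubleScale

theorem mainTheorem4 (β α γ : ℝ) (hβ0 : 0 < β) (hβ1 : β < 1)
    (hα : 0 < α) (hαγ : α ≤ γ) (hγ : γ < 2) :
    ∃ C : ℝ, 0 < C ∧ ∀ T : ℝ, 0 < T → ∀ f : L2D, MemHdot α γ f →
      ∃ u : ℝ → ℝ → ℝ,
        IsWeakSolution β α γ T f u ∧
        (∀ v : ℝ → ℝ → ℝ, IsWeakSolution β α γ T f v →
          ∀ t ∈ Ioc 0 T, v t =ᵐ[measD] u t) ∧
        (∀ t ∈ Icc 0 T, MemLp (u t) 2 measD) ∧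
        u 0 =ᵐ[measD] f ∧
        (∀ t ∈ Icc 0 T,
          HasSum (fun n => (mittagLeffler β 1 (-eig α γ n * t ^ β) * coeff f n) • psi n)
            (toL2 (u t))) ∧
        ContinuousOn (fun t => toL2 (u t)) (Icc 0 T) ∧
        ContinuousOnHdot α γ (fun t => toL2 (u t)) (Ioc 0 T) ∧
        ContinuousOn (caputoDeriv β fun t => toL2 (u t)) (Ioc 0 T) ∧
        ∀ t ∈ Ioc 0 T,
          hdotNorm α γ (toL2 (u t)) + ‖caputoDeriv β (fun s => toL2 (u s)) t‖ ≤
            C * t ^ (-β) * hdotNorm α γ f := by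
  have hG : 0 < Real.Gamma (β + 1) := Real.Gamma_pos_of_pos (by linarith)
  have hγ0 : 0 ≤ γ := hα.le.trans hαγ
  -- The Caputo derivative has the same norm as the solution in `Ḣ^{α,γ}`, so the decay constant
  -- `Γ(β+1)` counts twice.
  refine ⟨2 * Real.Gamma (β + 1), by positivity, fun T hT f hf => ?_⟩
  obtain ⟨u, hu, hae⟩ := exists_isWeakSolution hβ0 hβ1 hf T
  have hL : (fun t => toL2 (u t)) = solCurve β α γ f := funext fun t => toL2_eq_of_ae (hae t)
  have hL' : ∀ t, toL2 (u t) = solCurve β α γ f t := fun t => congrFun hL t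
  have hsub : Ioc 0 T ⊆ Ici 0 := fun t ht => ht.1.le
  refine ⟨u, hu, fun v hv t ht => hu.ae_eq hβ0 hβ1 hv ht,
    fun t _ => (memLp_congr_ae (hae t)).2 (Lp.memLp _), ?_, fun t ht => ?_, ?_, ⟨fun t ht => ?_,
    fun t ht => ?_⟩, ?_, fun t ht => ?_⟩
  · have := hae 0
    rwa [solCurve_zero hβ0 hβ1.le] at this
  · have h := hasSum_coeff_smul_psi (solCurve β α γ f t)
    simp_rw [coeff_solCurve hβ0 hβ1.le ht.1] at h
    rwa [hL']
  · rw [hL]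
    exact (continuousOn_solCurve hβ0 hβ1.le).mono Icc_subset_Ici_self
  · exact hu.memHdot t ht
  · simp_rw [hL']
    exact (tendsto_hdotNorm_solCurve_sub hβ0 hβ1.le hf ht.1.le).mono_left
      (nhdsWithin_mono _ hsub)
  · rw [hL]
    exact ((continuousOn_fracOp_solCurve hβ0 hβ1.le hf).mono hsub).congr fun t ht =>
      caputoDeriv_solCurve hβ0 hβ1 hf ht.1
  · have hb := hdotNorm_solCurve_le hβ0 hβ1.le hα.le hγ0 hf ht.1
    rw [hL, hL', caputoDeriv_solCurve hβ0 hβ1 hf ht.1,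
      norm_fracOp (memHdot_solCurve hβ0 hβ1.le hf ht.1.le)]
    linarith
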